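/- Let $\Gamma$ be a finite simple graph with $V=|V(\Gamma)|$ vertices, and let $A(\Gamma)=\langle\, v\in V(\Gamma)\mid vw=wv \text{ whenever } \{v,w\}\in E(\Gamma)\,\rangle$ be its right-angled Artin group. Let $\|g\|$ denote the word length of $g\in A(\Gamma)$ with respect to $V(\Gamma)^{\pm1}$, and let $\|g\|_*$ denote its star length, the least $\ell\ge 0$ such that $g$ is a product of $\ell$ elements each of which lies in the centralizer of some vertex. An element $g\neq 1$ is primitive if it is not of the form $k^n$ with $k\in A(\Gamma)$ and $n\ge 2$. A quasi-root decomposition of $h$ is an expression $h=ag^nb$ with $a,b,g\in A(\Gamma)$, $g\ne1$, $n\ge1$ and $\|h\|=\|a\|+n\|g\|+\|b\|$; if moreover $\|a\|_*\le A$, $\|b\|_*\le B$ and $\|g\|_*\le r$, then $g$ is called an $(A,B,r)^*$-quasi-root of $h$. Let $h\in A(\Gamma)$, and let $A,B\ge 0$ and $r\ge 1$ be real numbers with $$\|h\|_*\ \ge\ 2A+2B+(2V+3)r+2 .$$ Then any two primitive $(A,B,r)^*$-quasi-roots of $h$ are conjugate in $A(\Gamma)$. Moreover, their leftward and rightward extractions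 are unique: if $h=a_1g_1^{n_1}b_1=a_2g_2^{n_2}b_2$ are two quasi-root decompositions of $h$ such that, for $i=1,2$, $g_i$ is primitive, $\|a_i\|_*\le A$, $\|b_i\|_*\le B$ and $\|g_i\|_*\le r$, then $$a_1g_1a_1^{-1}=a_2g_2a_2^{-1}\qquad\text{and}\qquad b_1^{-1}g_1b_1=b_2^{-1}g_2b_2 .$$ -/

import Mathlib

universe u

/-- The right-angled Artin group of `Γ`: one generator for each vertex, and adjacent
vertices commute. -/
abbrev RAAG {V : Type u} (Γ : SimpleGraph V) : Type u :=
  PresentedGroup {x : FreeGroup V | ∃ v w : V, Γ.Adj v w ∧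
    x = FreeGroup.of v * FreeGroup.of w * (FreeGroup.of v)⁻¹ * (FreeGroup.of w)⁻¹}

namespace RAAG

variable {V : Type u} {Γ : SimpleGraph V}

/-- The generator of the right-angled Artin group that belongs to the vertex `v`. -/
def gen (Γ : SimpleGraph V) (v : V) : RAAG Γ := PresentedGroup.of v

/-- A letter is a vertex or the formal inverse of a vertex; `(v, true)` stands for `v` and
`(v, false)` for its inverse. -/
def letterVal (Γ : SimpleGraph V) (x : V × Bool) : RAAG Γ :=
  if x.2 then gen Γ x.1 else (gen Γ x.1)⁻¹

/-- The element of the group represented by a word. -/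
def wordVal (Γ : SimpleGraph V) (w : List (V × Bool)) : RAAG Γ :=
  (w.map (letterVal Γ)).prod

/-- The word length: the least length of a word in the vertices and their inverses that
represents `g`. -/
noncomputable def wordLength (g : RAAG Γ) : ℕ :=
  sInf {n : ℕ | ∃ w : List (V × Bool), wordVal Γ w = g ∧ w.length = n}

/-- A star-word is an element of the centralizer of some vertex. -/
def IsStarWord (g : RAAG Γ) : Prop :=
  ∃ v : V, g ∈ Subgroup.centralizer {gen Γ v}

/-- The star length: the least number of star-words whose product is `g`. -/
noncomputable def starLength (g : RAAG Γ) : ℕ :=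
  sInf {n : ℕ | ∃ l : List (RAAG Γ), (∀ s ∈ l, IsStarWord s) ∧ l.prod = g ∧ l.length = n}

/-- A nontrivial element that is not a proper power. -/
def IsPrimitive (g : RAAG Γ) : Prop :=
  g ≠ 1 ∧ ∀ (k : RAAG Γ) (n : ℕ), 2 ≤ n → g ≠ k ^ n

/-- `h = a * g ^ n * b` is a quasi-root decomposition of `h` with quasi-root `g`. -/
structure IsQuasiRootDecomp (h a g b : RAAG Γ) (n : ℕ) : Prop where
  ne_one : g ≠ 1
  one_le : 1 ≤ n
  eq_mul : h = a * g ^ n * b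
  length_eq : wordLength h = wordLength a + wordLength b + n * wordLength g

/-- A quasi-root decomposition whose parts satisfy the star-length bounds `A`, `B`, `r`. -/
structure IsStarQuasiRootDecomp (A B r : ℝ) (h a g b : RAAG Γ) (n : ℕ) : Prop
    extends IsQuasiRootDecomp h a g b n where
  left_le : (starLength a : ℝ) ≤ A
  right_le : (starLength b : ℝ) ≤ B
  root_le : (starLength g : ℝ) ≤ r

/-- `g` is an `(A, B, r)^*`-quasi-root of `h`. -/
def IsStarQuasiRoot (A B r : ℝ) (h g : RAAG Γ) : Prop :=
  ∃ (a b : RAAG Γ) (n : ℕ), IsStarQuasiRootDecomp A B r h a g b n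

/-- Every element is represented by a word, so that the minimum in `wordLength` is attained. -/
theorem exists_wordVal_eq (g : RAAG Γ) : ∃ w : List (V × Bool), wordVal Γ w = g := by
  obtain ⟨x, rfl⟩ := PresentedGroup.mk_surjective _ g
  induction x using FreeGroup.induction_on with
  | C1 => exact ⟨[], by simp [wordVal]⟩
  | of v => exact ⟨[(v, true)], by simp [wordVal, letterVal, gen, PresentedGroup.of]⟩
  | inv_of v _ => exact ⟨[(v, false)], by simp [wordVal, letterVal, gen, PresentedGroup.of]⟩
  | mul x y hx hy =>
    obtain ⟨w, hw⟩ := hx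
    obtain ⟨w', hw'⟩ := hy
    exact ⟨w ++ w', by rw [map_mul, ← hw, ← hw']; simp [wordVal]⟩

/-- Every letter is a star-word, so that the minimum in `starLength` is attained. -/
theorem exists_starWords_prod_eq (g : RAAG Γ) :
    ∃ l : List (RAAG Γ), (∀ s ∈ l, IsStarWord s) ∧ l.prod = g := by
  obtain ⟨w, hw⟩ := exists_wordVal_eq g
  refine ⟨w.map (letterVal Γ), ?_, hw⟩
  intro s hs
  obtain ⟨⟨v, ε⟩, -, rfl⟩ := List.mem_map.1 hs
  refine ⟨v, ?_⟩
  rw [Subgroup.mem_centralizer_singleton_iff]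
  cases ε <;> simp [letterVal]

end RAAG

/-! A reduced word is determined by its element up to exchanges of commuting letters, so two
quasi-root decompositions of `h` give words `A₁G₁⋯G₁B₁` and `A₂G₂⋯G₂B₂` related by `Swap`. The
`j`-th occurrence of a vertex `y` survives exchanges, and so does its wall, the conjugate of `y` by
the prefix before it (`Swap.wall_eq`). Moving one period ahead inside `AG⋯GB` conjugates walls by
`aga⁻¹` (`wall_period`). The same walls thus carry two shifts, by `u = a₁g₁a₁⁻¹` and by `v =
a₂g₂a₂⁻¹`, and the claim is `u = v`.

`exists_middle` rewrites the word as `XRE`, where `X` and `E` have bounded star length and every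
letter of `R` has room for both shifts. Since `h` has large star length, two stars cannot cover `R`.
An element commuting with all walls of `R` is, after conjugation by `X`, in the centralizer of every
letter of `R`; if nontrivial, it would put `R` in a single star. Hence elements acting alike on
these walls are equal.

Applied to the commutator, this shows that `u` and `v` commute. A Fine–Wilf argument
(`iterate_eq_of_shift`) on occurrence counts shows that the ratio of the two periods agrees at
nonadjacent vertices of `R`; two different ratios would split `R` as a join, covered by two stars.
With the common ratio `p : q` in lowest terms, the same argument on walls gives `u ^ q = v ^ p`.
Then `u` and `v` are the `p`-th and `q`-th powers of one element (`exists_common_root`), and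
primitivity forces `p = q = 1`. Conjugating by `h` gives the rightward extractions. -/

namespace RAAG

variable {V : Type u} {Γ : SimpleGraph V}

/-! ### Words up to exchanges of commuting letters. -/

/-- The formal inverse of a letter. -/
def flip (x : V × Bool) : V × Bool := (x.1, !x.2)

@[simp] theorem flip_flip (x : V × Bool) : flip (flip x) = x := by simp [flip]

@[simp] theorem flip_fst (x : V × Bool) : (flip x).1 = x.1 := rfl

@[simp] theorem letterVal_flip (x : V × Bool) : letterVal Γ (flip x) = (letterVal Γ x)⁻¹ := by
  rcases x with ⟨v, _ | _⟩ <;> simp [letterVal, flip]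

theorem gen_commute {v w : V} (h : Γ.Adj v w) : Commute (gen Γ v) (gen Γ w) := by
  have : (PresentedGroup.mk {x : FreeGroup V | ∃ v w : V, Γ.Adj v w ∧
      x = FreeGroup.of v * FreeGroup.of w * (FreeGroup.of v)⁻¹ * (FreeGroup.of w)⁻¹}
      (FreeGroup.of v * FreeGroup.of w * (FreeGroup.of v)⁻¹ * (FreeGroup.of w)⁻¹)) = 1 :=
    PresentedGroup.one_of_mem ⟨v, w, h, rfl⟩
  simp only [map_mul, map_inv] at this
  rw [mul_inv_eq_one, mul_inv_eq_iff_eq_mul] at this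
  exact this

theorem commute_letterVal_iff {x : V × Bool} {z : RAAG Γ} :
    Commute z (letterVal Γ x) ↔ Commute z (gen Γ x.1) := by
  unfold letterVal
  split_ifs
  · rfl
  · exact Commute.inv_right_iff

theorem letterVal_commute {x y : V × Bool} (h : Γ.Adj x.1 y.1) :
    Commute (letterVal Γ x) (letterVal Γ y) :=
  commute_letterVal_iff.2 (commute_letterVal_iff.2 (gen_commute h).symm).symm

@[simp] theorem wordVal_nil : wordVal Γ [] = 1 := rfl

@[simp] theorem wordVal_cons (x : V × Bool) (W : List (V × Bool)) :
    wordVal Γ (x :: W) = letterVal Γ x * wordVal Γ W := by simp [wordVal]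

@[simp] theorem wordVal_append (U W : List (V × Bool)) :
    wordVal Γ (U ++ W) = wordVal Γ U * wordVal Γ W := by simp [wordVal]

/-- Words that differ by exchanging neighbouring letters whose vertices are adjacent. -/
inductive Swap (Γ : SimpleGraph V) : List (V × Bool) → List (V × Bool) → Prop
  | nil : Swap Γ [] []
  | cons (x : V × Bool) {W W' : List (V × Bool)} : Swap Γ W W' → Swap Γ (x :: W) (x :: W')
  | swap (x y : V × Bool) (W : List (V × Bool)) :
      Γ.Adj x.1 y.1 → Swap Γ (x :: y :: W) (y :: x :: W)
  | trans {U W W' : List (V × Bool)} : Swap Γ U W → Swap Γ W W' → Swap Γ U W'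

namespace Swap

variable {U U' W W' : List (V × Bool)}

theorem refl : ∀ W : List (V × Bool), Swap Γ W W
  | [] => nil
  | x :: W => cons x (refl W)

theorem symm (h : Swap Γ W W') : Swap Γ W' W := by
  induction h with
  | nil => exact nil
  | cons x _ ih => exact cons x ih
  | swap x y W h => exact swap y x W h.symm
  | trans _ _ ih ih' => exact ih'.trans ih

theorem perm (h : Swap Γ W W') : W.Perm W' := by
  induction h with
  | nil => exact List.Perm.nil
  | cons x _ ih => exact ih.cons x
  | swap x y W _ => exact List.Perm.swap y x W
  | trans _ _ ih ih' => exact ih.trans ih'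

theorem wordVal_eq (h : Swap Γ W W') : wordVal Γ W = wordVal Γ W' := by
  induction h with
  | nil => rfl
  | cons x _ ih => simp [ih]
  | swap x y W h => simp [← mul_assoc, (letterVal_commute h).eq]
  | trans _ _ ih ih' => exact ih.trans ih'

theorem append_left (U : List (V × Bool)) (h : Swap Γ W W') : Swap Γ (U ++ W) (U ++ W') := by
  induction U with
  | nil => exact h
  | cons x U ih => exact cons x ih

theorem append_right (U : List (V × Bool)) (h : Swap Γ W W') : Swap Γ (W ++ U) (W' ++ U) := by
  induction h with
  | nil => exact refl U
  | cons x _ ih => exact cons x ih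
  | swap x y W h => exact swap x y _ h
  | trans _ _ ih ih' => exact ih.trans ih'

theorem append (h : Swap Γ W W') (h' : Swap Γ U U') : Swap Γ (W ++ U) (W' ++ U') :=
  (h.append_right U).trans (h'.append_left W')

theorem cons_append (x : V × Bool) (W : List (V × Bool)) {U : List (V × Bool)}
    (h : ∀ b ∈ U, Γ.Adj x.1 b.1) : Swap Γ (x :: (U ++ W)) (U ++ x :: W) := by
  induction U with
  | nil => exact refl _
  | cons y U ih =>
    exact (swap x y _ (h y (by simp))).trans
      (cons y (ih fun b hb => h b (List.mem_cons_of_mem _ hb)))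

theorem append_comm {U W : List (V × Bool)} (h : ∀ a ∈ U, ∀ b ∈ W, Γ.Adj a.1 b.1) :
    Swap Γ (U ++ W) (W ++ U) := by
  induction U with
  | nil => simpa using refl W
  | cons x U ih =>
    exact (cons x (ih fun a ha => h a (List.mem_cons_of_mem _ ha))).trans
      (cons_append x U (h x (by simp)))

theorem reverse (h : Swap Γ W W') : Swap Γ W.reverse W'.reverse := by
  induction h with
  | nil => exact nil
  | cons x _ ih => simpa using ih.append_right [x]
  | swap x y W h =>
    simpa using (swap y x [] h.symm).append_left W.reverse
  | trans _ _ ih ih' => exact ih.trans ih'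

/-- Exchanges can be followed on any subset of the letters. This lets star covers pass to subwords.
-/
theorem exists_sublist (h : Swap Γ W W') {U : List (V × Bool)} (hU : U.Sublist W) :
    ∃ U', U'.Sublist W' ∧ Swap Γ U U' := by
  induction h generalizing U with
  | nil => exact ⟨U, hU, refl U⟩
  | cons x _ ih =>
    cases hU with
    | cons _ h =>
      obtain ⟨U', h₁, h₂⟩ := ih h
      exact ⟨U', h₁.cons x, h₂⟩
    | cons_cons _ h =>
      obtain ⟨U', h₁, h₂⟩ := ih h
      exact ⟨x :: U', h₁.cons_cons x, h₂.cons x⟩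
  | swap x y W hxy =>
    cases hU with
    | cons _ h =>
      cases h with
      | cons _ h => exact ⟨_, (h.cons x).cons y, refl _⟩
      | cons_cons _ h => exact ⟨_, (h.cons x).cons_cons y, refl _⟩
    | cons_cons _ h =>
      cases h with
      | cons _ h => exact ⟨_, (h.cons_cons x).cons y, refl _⟩
      | cons_cons _ h => exact ⟨_, (h.cons_cons x).cons_cons y, swap _ _ _ hxy⟩
  | trans _ _ ih ih' =>
    obtain ⟨U₁, h₁, h₂⟩ := ih hU
    obtain ⟨U₂, h₃, h₄⟩ := ih' h₁
    exact ⟨U₂, h₃, h₂.trans h₄⟩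

end Swap

/-! ### Cancellation and reduced words. -/

open scoped Classical in
/-- Removes the letter `x` from the front of a word, up to exchanges of commuting letters, if
this is possible. -/
noncomputable def strip (Γ : SimpleGraph V) (x : V × Bool) :
    List (V × Bool) → Option (List (V × Bool))
  | [] => none
  | y :: W => if y = x then some W else
      if Γ.Adj x.1 y.1 then (strip Γ x W).map (y :: ·) else none

section strip

variable {W W' : List (V × Bool)} {x y : V × Bool}

@[simp] theorem strip_nil : strip Γ x [] = none := rfl

@[simp] theorem strip_cons_self : strip Γ x (x :: W) = some W := by simp [strip]

theorem strip_cons_of_adj (h : Γ.Adj x.1 y.1) :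
    strip Γ x (y :: W) = (strip Γ x W).map (y :: ·) := by
  have : y ≠ x := by rintro rfl; exact Γ.irrefl h
  simp [strip, h, this]

theorem strip_cons_of_not (h : ¬ Γ.Adj x.1 y.1) (h' : y ≠ x) : strip Γ x (y :: W) = none := by
  simp [strip, h, h']

theorem swap_of_strip (h : strip Γ x W = some W') : Swap Γ W (x :: W') := by
  induction W generalizing W' with
  | nil => simp at h
  | cons y W ih =>
    by_cases hyx : y = x
    · subst hyx
      simp only [strip_cons_self, Option.some.injEq] at h
      subst h
      exact Swap.refl _
    · by_cases hadj : Γ.Adj x.1 y.1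
      · rw [strip_cons_of_adj hadj, Option.map_eq_some_iff] at h
        obtain ⟨W₁, h₁, rfl⟩ := h
        exact ((ih h₁).cons y).trans (Swap.swap y x W₁ hadj.symm)
      · rw [strip_cons_of_not hadj hyx] at h
        cases h

/-- Whether `x` can be brought to the front, and what then remains, depends only on the class of the
word; this makes `mulLeft` well defined on classes. -/
theorem Swap.strip (h : Swap Γ W W') (x : V × Bool) :
    Option.Rel (Swap Γ) (strip Γ x W) (strip Γ x W') := by
  induction h with
  | nil => exact Option.Rel.none
  | cons y hW ih =>
    by_cases hyx : y = x
    · subst hyx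
      simpa using Option.Rel.some hW
    · by_cases hadj : Γ.Adj x.1 y.1
      · rw [strip_cons_of_adj hadj, strip_cons_of_adj hadj]
        generalize RAAG.strip Γ x _ = o₁ at *
        generalize RAAG.strip Γ x _ = o₂ at *
        cases ih with
        | none => exact Option.Rel.none
        | some h => exact Option.Rel.some (h.cons y)
      · rw [strip_cons_of_not hadj hyx, strip_cons_of_not hadj hyx]
        exact Option.Rel.none
  | swap a b W hab =>
    have hba : a ≠ b := by rintro rfl; exact Γ.irrefl hab
    by_cases hax : a = x
    · subst hax
      rw [strip_cons_self, strip_cons_of_adj hab, strip_cons_self]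
      exact Option.Rel.some (Swap.refl _)
    by_cases hbx : b = x
    · subst hbx
      rw [strip_cons_self, strip_cons_of_adj hab.symm, strip_cons_self]
      exact Option.Rel.some (Swap.refl _)
    by_cases ha : Γ.Adj x.1 a.1 <;> by_cases hb : Γ.Adj x.1 b.1
    · simp only [strip_cons_of_adj ha, strip_cons_of_adj hb]
      cases RAAG.strip Γ x W with
      | none => exact Option.Rel.none
      | some W' => exact Option.Rel.some (Swap.swap _ _ _ hab)
    · simp only [strip_cons_of_adj ha, strip_cons_of_not hb hbx]
      exact Option.Rel.none
    · simp only [strip_cons_of_adj hb, strip_cons_of_not ha hax]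
      exact Option.Rel.none
    · simp only [strip_cons_of_not hb hbx, strip_cons_of_not ha hax]
      exact Option.Rel.none
  | @trans U W W' _ _ ih ih' =>
    generalize RAAG.strip Γ x U = o₁ at *
    generalize RAAG.strip Γ x W = o₂ at *
    generalize RAAG.strip Γ x W' = o₃ at *
    cases ih with
    | none => cases ih'; exact Option.Rel.none
    | some h => cases ih' with
      | some h' => exact Option.Rel.some (h.trans h')

theorem Swap.strip_eq_none (h : Swap Γ W W') (hx : RAAG.strip Γ x W = none) :
    RAAG.strip Γ x W' = none := by
  have := h.strip x
  rw [hx] at this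
  generalize RAAG.strip Γ x W' = o at *
  cases this
  rfl

theorem Swap.strip_eq_some (h : Swap Γ W (x :: W')) :
    ∃ W₁, RAAG.strip Γ x W = some W₁ ∧ Swap Γ W₁ W' := by
  have := h.strip x
  rw [strip_cons_self] at this
  generalize RAAG.strip Γ x W = o at *
  cases this with
  | some h => exact ⟨_, rfl, h⟩

end strip

/-- A word in which no letter can be brought next to its inverse. -/
def IsReduced (Γ : SimpleGraph V) : List (V × Bool) → Prop
  | [] => True
  | x :: W => IsReduced Γ W ∧ strip Γ (flip x) W = none

/-- Left multiplication of a reduced word by a letter. -/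
noncomputable def mulLeft (Γ : SimpleGraph V) (x : V × Bool) (W : List (V × Bool)) :
    List (V × Bool) :=
  (strip Γ (flip x) W).getD (x :: W)

section reduced

variable {U W W' : List (V × Bool)} {x y : V × Bool}

theorem isReduced_nil : IsReduced Γ [] := trivial

theorem IsReduced.swap (hW : IsReduced Γ W) (h : Swap Γ W W') : IsReduced Γ W' := by
  induction h with
  | nil => trivial
  | cons x h ih => exact ⟨ih hW.1, h.strip_eq_none hW.2⟩
  | swap x y W h =>
    obtain ⟨⟨h₁, h₂⟩, h₃⟩ := hW
    rw [strip_cons_of_adj (x := flip x) h, Option.map_eq_none_iff] at h₃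
    refine ⟨⟨h₁, h₃⟩, ?_⟩
    rw [strip_cons_of_adj (x := flip y) h.symm, h₂]
    rfl
  | trans _ _ ih ih' => exact ih' (ih hW)

theorem mulLeft_of_none (h : strip Γ (flip x) W = none) : mulLeft Γ x W = x :: W := by
  simp [mulLeft, h]

theorem mulLeft_of_some (h : strip Γ (flip x) W = some W') : mulLeft Γ x W = W' := by
  simp [mulLeft, h]

theorem IsReduced.mulLeft (hW : IsReduced Γ W) (x : V × Bool) : IsReduced Γ (mulLeft Γ x W) := by
  cases h : strip Γ (flip x) W with
  | none =>
    rw [mulLeft_of_none h]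
    exact ⟨hW, h⟩
  | some W' =>
    rw [mulLeft_of_some h]
    exact (hW.swap (swap_of_strip h)).1

theorem Swap.mulLeft (h : Swap Γ W W') (x : V × Bool) :
    Swap Γ (mulLeft Γ x W) (mulLeft Γ x W') := by
  have := h.strip (flip x)
  unfold RAAG.mulLeft
  generalize RAAG.strip Γ (flip x) W = o₁ at *
  generalize RAAG.strip Γ (flip x) W' = o₂ at *
  cases this with
  | none => exact h.cons x
  | some h => exact h

theorem swap_mulLeft_of_swap_cons (h : Swap Γ W (flip x :: W')) :
    Swap Γ (mulLeft Γ x W) W' := by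
  obtain ⟨W₁, h₁, h₂⟩ := h.strip_eq_some
  rwa [mulLeft_of_some h₁]

/-- Reducedness matters when `x` is cancelled from `W`: the remainder must not offer a further `flip
x`, or putting `x` back would cancel again. -/
theorem mulLeft_mulLeft_flip (hW : IsReduced Γ W) (x : V × Bool) :
    Swap Γ (mulLeft Γ x (mulLeft Γ (flip x) W)) W := by
  cases h : strip Γ x W with
  | none =>
    rw [mulLeft_of_none (x := flip x) (by simpa using h)]
    exact swap_mulLeft_of_swap_cons (Swap.refl _)
  | some W' =>
    have h₁ := swap_of_strip h
    have h₂ := hW.swap h₁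
    rw [mulLeft_of_some (x := flip x) (by simpa using h), mulLeft_of_none h₂.2]
    exact h₁.symm

theorem mulLeft_cons_of_adj (h : Γ.Adj x.1 y.1) :
    Swap Γ (mulLeft Γ x (y :: W)) (y :: mulLeft Γ x W) := by
  cases hs : strip Γ (flip x) W with
  | none =>
    rw [mulLeft_of_none hs, mulLeft_of_none (by rw [strip_cons_of_adj (x := flip x) h, hs]; rfl)]
    exact Swap.swap _ _ _ h
  | some W' =>
    rw [mulLeft_of_some hs,
      mulLeft_of_some (W' := y :: W') (by rw [strip_cons_of_adj (x := flip x) h, hs]; rfl)]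
    exact Swap.refl _

theorem mulLeft_comm (hxy : Γ.Adj x.1 y.1) (W : List (V × Bool)) :
    Swap Γ (mulLeft Γ x (mulLeft Γ y W)) (mulLeft Γ y (mulLeft Γ x W)) := by
  have key : ∀ {x y : V × Bool}, Γ.Adj x.1 y.1 → ∀ W', strip Γ (flip x) W = some W' →
      Swap Γ (mulLeft Γ x (mulLeft Γ y W)) (mulLeft Γ y (mulLeft Γ x W)) := by
    intro x y hxy W' h
    have h₁ := swap_of_strip h
    rw [mulLeft_of_some h]
    refine swap_mulLeft_of_swap_cons ((h₁.mulLeft y).trans ?_)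
    exact mulLeft_cons_of_adj (y := flip x) hxy.symm
  cases hx : strip Γ (flip x) W with
  | some W' => exact key hxy W' hx
  | none =>
    cases hy : strip Γ (flip y) W with
    | some W' => exact (key hxy.symm W' hy).symm
    | none =>
      rw [mulLeft_of_none hx, mulLeft_of_none hy]
      refine (mulLeft_cons_of_adj hxy).trans (Swap.trans ?_ (mulLeft_cons_of_adj hxy.symm).symm)
      rw [mulLeft_of_none hx, mulLeft_of_none hy]
      exact Swap.swap _ _ _ hxy.symm

theorem wordVal_mulLeft (x : V × Bool) (W : List (V × Bool)) :
    wordVal Γ (mulLeft Γ x W) = letterVal Γ x * wordVal Γ W := by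
  cases h : strip Γ (flip x) W with
  | none => simp [mulLeft_of_none h]
  | some W' => simp [mulLeft_of_some h, (swap_of_strip h).wordVal_eq]

/-- The reduced word obtained from `W` by free reduction modulo commutation. -/
noncomputable def reduce (Γ : SimpleGraph V) (W : List (V × Bool)) : List (V × Bool) :=
  W.foldr (mulLeft Γ) []

theorem isReduced_reduce (W : List (V × Bool)) : IsReduced Γ (reduce Γ W) := by
  induction W with
  | nil => trivial
  | cons x W ih => exact ih.mulLeft x

theorem wordVal_reduce (W : List (V × Bool)) : wordVal Γ (reduce Γ W) = wordVal Γ W := by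
  induction W with
  | nil => rfl
  | cons x W ih => rw [wordVal_cons, ← ih]; exact wordVal_mulLeft x (reduce Γ W)

theorem IsReduced.reduce_eq (h : IsReduced Γ W) : reduce Γ W = W := by
  induction W with
  | nil => rfl
  | cons x W ih =>
    change RAAG.mulLeft Γ x (reduce Γ W) = _
    rw [ih h.1, mulLeft_of_none h.2]

/-- Reduction only deletes letters, up to exchanges. Hence it preserves star covers, and a word that
it does not shorten is already reduced. -/
theorem exists_sublist_swap_reduce (W : List (V × Bool)) :
    ∃ U, U.Sublist W ∧ Swap Γ U (reduce Γ W) := by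
  induction W with
  | nil => exact ⟨[], List.Sublist.refl _, Swap.nil⟩
  | cons x W ih =>
    obtain ⟨U, h₁, h₂⟩ := ih
    change ∃ U', U'.Sublist (x :: W) ∧ Swap Γ U' (mulLeft Γ x (reduce Γ W))
    cases h : strip Γ (flip x) (reduce Γ W) with
    | none =>
      rw [mulLeft_of_none h]
      exact ⟨x :: U, h₁.cons_cons x, h₂.cons x⟩
    | some W' =>
      rw [mulLeft_of_some h]
      obtain ⟨U', h₃, h₄⟩ := (h₂.trans (swap_of_strip h)).symm.exists_sublist
        (List.sublist_cons_self (flip x) W')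
      exact ⟨U', (h₃.trans h₁).cons x, h₄.symm⟩

end reduced

/-! ### Uniqueness of reduced words, by an action on their classes. -/

/-- Reduced words up to exchanges of commuting letters. -/
def reducedSetoid (Γ : SimpleGraph V) : Setoid {W : List (V × Bool) // IsReduced Γ W} where
  r W W' := Swap Γ W.1 W'.1
  iseqv := ⟨fun W => Swap.refl W.1, Swap.symm, Swap.trans⟩

/-- The set of reduced words up to exchanges of commuting letters. -/
abbrev ReducedClass (Γ : SimpleGraph V) : Type u := Quotient (reducedSetoid Γ)

/-- The action of a letter on classes of reduced words. -/
noncomputable def letterAct (Γ : SimpleGraph V) (x : V × Bool) :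
    ReducedClass Γ → ReducedClass Γ :=
  Quotient.map' (s₁ := reducedSetoid Γ) (s₂ := reducedSetoid Γ)
    (fun W => ⟨mulLeft Γ x W.1, W.2.mulLeft x⟩) fun _ _ h => Swap.mulLeft h x

theorem letterAct_flip (x : V × Bool) (c : ReducedClass Γ) :
    letterAct Γ x (letterAct Γ (flip x) c) = c := by
  induction c using Quotient.inductionOn with
  | h W => exact Quotient.sound (mulLeft_mulLeft_flip W.2 x)

theorem letterAct_comm {x y : V × Bool} (h : Γ.Adj x.1 y.1) (c : ReducedClass Γ) :
    letterAct Γ x (letterAct Γ y c) = letterAct Γ y (letterAct Γ x c) := by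
  induction c using Quotient.inductionOn with
  | h W => exact Quotient.sound (mulLeft_comm h W.1)

/-- The permutation of the classes of reduced words given by a vertex. -/
noncomputable def vertexPerm (Γ : SimpleGraph V) (v : V) : Equiv.Perm (ReducedClass Γ) where
  toFun := letterAct Γ (v, true)
  invFun := letterAct Γ (v, false)
  left_inv := letterAct_flip (v, false)
  right_inv := letterAct_flip (v, true)

/-- The action of the group on classes of reduced words. -/
noncomputable def reducedAction (Γ : SimpleGraph V) : RAAG Γ →* Equiv.Perm (ReducedClass Γ) :=
  PresentedGroup.toGroup (f := vertexPerm Γ) <| by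
    rintro _ ⟨v, w, h, rfl⟩
    simp only [map_mul, map_inv, FreeGroup.lift_apply_of]
    rw [mul_inv_eq_one, mul_inv_eq_iff_eq_mul]
    ext c
    exact letterAct_comm (x := (v, true)) (y := (w, true)) h c

theorem reducedAction_letterVal (x : V × Bool) (c : ReducedClass Γ) :
    reducedAction Γ (letterVal Γ x) c = letterAct Γ x c := by
  have h : ∀ v, reducedAction Γ (gen Γ v) = vertexPerm Γ v := fun v =>
    PresentedGroup.toGroup.of _
  rcases x with ⟨v, _ | _⟩
  · simp only [letterVal, Bool.false_eq_true, if_false, map_inv, h]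
    rfl
  · simp only [letterVal, if_true, h]
    rfl

/-- Acting on the empty word recovers the reduction, which therefore depends only on the group
element, up to exchanges. -/
theorem reducedAction_wordVal (W : List (V × Bool)) :
    reducedAction Γ (wordVal Γ W) (Quotient.mk (reducedSetoid Γ) ⟨[], isReduced_nil⟩) =
      Quotient.mk (reducedSetoid Γ) ⟨reduce Γ W, isReduced_reduce W⟩ := by
  induction W with
  | nil => simp; rfl
  | cons x W ih =>
    rw [wordVal_cons, map_mul, Equiv.Perm.mul_apply, ih, reducedAction_letterVal]
    rfl

/-- Words representing the same element have the same reduction, up to exchanges. -/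
theorem swap_reduce_of_wordVal_eq {W W' : List (V × Bool)} (h : wordVal Γ W = wordVal Γ W') :
    Swap Γ (reduce Γ W) (reduce Γ W') := by
  have := reducedAction_wordVal (Γ := Γ) W
  rw [h, reducedAction_wordVal] at this
  exact (Quotient.exact this).symm

theorem wordLength_le (W : List (V × Bool)) : wordLength (wordVal Γ W) ≤ W.length :=
  Nat.sInf_le ⟨W, rfl, rfl⟩

theorem exists_geodesic (g : RAAG Γ) :
    ∃ W, wordVal Γ W = g ∧ W.length = wordLength g := by
  obtain ⟨W, hW⟩ := exists_wordVal_eq g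
  exact Nat.sInf_mem (s := {n : ℕ | ∃ w : List (V × Bool), wordVal Γ w = g ∧ w.length = n})
    ⟨W.length, W, hW, rfl⟩

theorem swap_reduce_of_length_le {W : List (V × Bool)} (h : W.length ≤ (reduce Γ W).length) :
    Swap Γ W (reduce Γ W) := by
  obtain ⟨U, h₁, h₂⟩ := exists_sublist_swap_reduce (Γ := Γ) W
  have : U = W := h₁.eq_of_length_le (by rw [h₂.perm.length_eq]; exact h)
  exact this ▸ h₂

theorem isReduced_of_geodesic {W : List (V × Bool)}
    (h : W.length = wordLength (wordVal Γ W)) : IsReduced Γ W := by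
  refine (isReduced_reduce W).swap (swap_reduce_of_length_le ?_).symm
  rw [h, ← wordVal_reduce W]
  exact wordLength_le _

/-- Reduced words of the same element differ by exchanges of commuting letters. -/
theorem IsReduced.swap_of_wordVal_eq {W W' : List (V × Bool)} (hW : IsReduced Γ W)
    (hW' : IsReduced Γ W') (h : wordVal Γ W = wordVal Γ W') : Swap Γ W W' := by
  have := swap_reduce_of_wordVal_eq h
  rwa [hW.reduce_eq, hW'.reduce_eq] at this

/-! ### Centralizers of vertices and covers by stars. -/

/-- No `x` inside `W` can reach the front, so it is the final one that does, passing every letter of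
`W`. -/
theorem adj_of_strip_append {x : V × Bool} {W : List (V × Bool)} (h : strip Γ x W = none)
    (h' : strip Γ x (W ++ [x]) ≠ none) : ∀ b ∈ W, Γ.Adj x.1 b.1 := by
  induction W with
  | nil => simp
  | cons y W ih =>
    have hyx : y ≠ x := by
      rintro rfl
      simp at h
    by_cases hadj : Γ.Adj x.1 y.1
    · rw [strip_cons_of_adj hadj, Option.map_eq_none_iff] at h
      rw [List.cons_append, strip_cons_of_adj hadj, Ne, Option.map_eq_none_iff] at h'
      intro b hb
      rcases List.mem_cons.1 hb with rfl | hb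
      · exact hadj
      · exact ih h h' b hb
    · rw [List.cons_append, strip_cons_of_not hadj hyx] at h'
      exact absurd rfl h'

/-- A reduced word of an element commuting with a vertex has all its letters in the star of that
vertex. -/
theorem IsReduced.mem_star_of_commute {v : V} {W : List (V × Bool)} (hW : IsReduced Γ W)
    (h : Commute (gen Γ v) (wordVal Γ W)) : ∀ b ∈ W, b.1 = v ∨ Γ.Adj v b.1 := by
  induction hn : W.length using Nat.strong_induction_on generalizing W with
  | _ n ih =>
  have step : ∀ x : V × Bool, x.1 = v → ∀ W', strip Γ x W = some W' →
      ∀ b ∈ W, b.1 = v ∨ Γ.Adj v b.1 := by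
    intro x hx W' hs b hb
    have hsw := swap_of_strip hs
    have hlen := hsw.perm.length_eq
    simp only [List.length_cons] at hlen
    have hc : Commute (gen Γ v) (wordVal Γ W') := by
      have h₁ : wordVal Γ W' = (letterVal Γ x)⁻¹ * wordVal Γ W := by simp [hsw.wordVal_eq]
      rw [h₁]
      refine Commute.mul_right (Commute.inv_right (commute_letterVal_iff.2 ?_)) h
      rw [hx]
    rcases List.mem_cons.1 (hsw.perm.mem_iff.1 hb) with rfl | hb
    · exact Or.inl hx
    · exact ih W'.length (by omega) (hW.swap hsw).1 hc rfl b hb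
  cases h₁ : strip Γ (v, true) W with
  | some W' => exact step _ rfl W' h₁
  | none =>
    cases h₂ : strip Γ (v, false) W with
    | some W' => exact step _ rfl W' h₂
    | none =>
      -- Neither `v` nor its inverse can be brought to the front of `W`, so `vW` is reduced. The
      -- word `Wv` has the same value and length, hence differs from it by exchanges only.
      have hred : IsReduced Γ ((v, true) :: W) := ⟨hW, h₂⟩
      have hval : wordVal Γ ((v, true) :: W) = wordVal Γ (W ++ [(v, true)]) := by
        simpa [letterVal] using h.eq
      have hs := swap_reduce_of_wordVal_eq hval
      rw [hred.reduce_eq] at hs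
      have hs' := swap_reduce_of_length_le (Γ := Γ) (W := W ++ [(v, true)])
        (by rw [← hs.perm.length_eq]; simp)
      have hs'' := hs'.trans hs.symm
      obtain ⟨W₁, h₃, -⟩ := hs''.strip_eq_some
      intro b hb
      exact Or.inr (adj_of_strip_append h₁ (by rw [h₃]; simp) b hb)

/-- A word all of whose letters lie in the star of one vertex. -/
def InStar (Γ : SimpleGraph V) (W : List (V × Bool)) : Prop :=
  ∃ v, ∀ b ∈ W, b.1 = v ∨ Γ.Adj v b.1

theorem InStar.isStarWord {W : List (V × Bool)} (h : InStar Γ W) : IsStarWord (wordVal Γ W) := by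
  obtain ⟨v, hv⟩ := h
  refine ⟨v, Subgroup.mem_centralizer_singleton_iff.2 ?_⟩
  suffices Commute (wordVal Γ W) (gen Γ v) from this.eq
  induction W with
  | nil => exact Commute.one_left _
  | cons x W ih =>
    rw [wordVal_cons]
    refine Commute.mul_left (Commute.symm (commute_letterVal_iff.2 ?_))
      (ih fun b hb => hv b (List.mem_cons_of_mem _ hb))
    rcases hv x (by simp) with h | h
    · rw [h]
    · exact gen_commute h

/-- `HasStarCover Γ k W`: up to exchanges of commuting letters, `W` is a concatenation of `k`
words each of which has its letters in the star of one vertex. -/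
inductive HasStarCover (Γ : SimpleGraph V) : ℕ → List (V × Bool) → Prop
  | nil : HasStarCover Γ 0 []
  | cons {k : ℕ} {U W W' : List (V × Bool)} : InStar Γ U → HasStarCover Γ k W' →
      Swap Γ W (U ++ W') → HasStarCover Γ (k + 1) W

namespace HasStarCover

variable {k l : ℕ} {U W W' : List (V × Bool)}

theorem swap (h : HasStarCover Γ k W) (hs : Swap Γ W W') : HasStarCover Γ k W' := by
  cases h with
  | nil =>
    have := hs.perm.nil_eq
    subst this
    exact nil
  | cons h₁ h₂ h₃ => exact cons h₁ h₂ (hs.symm.trans h₃)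

theorem sublist (h : HasStarCover Γ k W) (hU : U.Sublist W) : HasStarCover Γ k U := by
  induction h generalizing U with
  | nil =>
    rw [List.sublist_nil.1 hU]
    exact nil
  | cons h₁ _ h₃ ih =>
    obtain ⟨U', h₄, h₅⟩ := h₃.exists_sublist hU
    obtain ⟨v, hv⟩ := h₁
    obtain ⟨U₁, U₂, rfl, h₆, h₇⟩ := List.sublist_append_iff.1 h₄
    exact cons ⟨v, fun b hb => hv b (h₆.subset hb)⟩ (ih h₇) h₅

theorem append (h : HasStarCover Γ k W) (h' : HasStarCover Γ l W') :
    HasStarCover Γ (k + l) (W ++ W') := by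
  induction h with
  | nil => simpa using h'
  | cons h₁ _ h₃ ih =>
    rw [Nat.add_right_comm]
    refine cons h₁ ih ?_
    rw [← List.append_assoc]
    exact h₃.append_right W'

theorem reverse (h : HasStarCover Γ k W) : HasStarCover Γ k W.reverse := by
  induction h with
  | nil => exact nil
  | @cons k U W W' h₁ _ h₃ ih =>
    obtain ⟨v, hv⟩ := h₁
    have h₁' : HasStarCover Γ 1 U.reverse :=
      cons (W' := []) ⟨v, fun b hb => hv b (List.mem_reverse.1 hb)⟩ nil
        (by simpa using Swap.refl _)
    refine (ih.append h₁').swap ?_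
    simpa using h₃.symm.reverse

theorem of_inStar (h : InStar Γ W) : HasStarCover Γ 1 W :=
  cons (W' := []) h nil (by simpa using Swap.refl _)

theorem starLength_le (h : HasStarCover Γ k W) : starLength (wordVal Γ W) ≤ k := by
  suffices ∃ l : List (RAAG Γ), (∀ s ∈ l, IsStarWord s) ∧ l.prod = wordVal Γ W ∧ l.length = k from
    Nat.sInf_le this
  induction h with
  | nil => exact ⟨[], by simp⟩
  | @cons k U W W' h₁ _ h₃ ih =>
    obtain ⟨l, h₄, h₅, h₆⟩ := ih
    refine ⟨wordVal Γ U :: l, ?_, by simp [h₅, h₃.wordVal_eq], by simp [h₆]⟩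
    intro s hs
    rcases List.mem_cons.1 hs with rfl | hs
    · exact h₁.isStarWord
    · exact h₄ s hs

end HasStarCover

theorem IsStarWord.exists_word {g : RAAG Γ} (h : IsStarWord g) :
    ∃ W, wordVal Γ W = g ∧ InStar Γ W := by
  obtain ⟨v, hv⟩ := h
  obtain ⟨W, rfl, hW⟩ := exists_geodesic g
  refine ⟨W, rfl, v, (isReduced_of_geodesic hW).mem_star_of_commute ?_⟩
  exact (Subgroup.mem_centralizer_singleton_iff.1 hv).symm

/-- Concatenating star-shaped words for an optimal factorization gives a word with a cover; its
reduction is a subword up to exchanges and agrees with `W` by uniqueness. -/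
theorem IsReduced.hasStarCover {W : List (V × Bool)} (hW : IsReduced Γ W) :
    HasStarCover Γ (starLength (wordVal Γ W)) W := by
  obtain ⟨l, h₁, h₂, h₃⟩ : ∃ l : List (RAAG Γ), (∀ s ∈ l, IsStarWord s) ∧
      l.prod = wordVal Γ W ∧ l.length = starLength (wordVal Γ W) := by
    obtain ⟨l, h₁, h₂⟩ := exists_starWords_prod_eq (wordVal Γ W)
    exact Nat.sInf_mem (s := {n : ℕ | ∃ l : List (RAAG Γ), (∀ s ∈ l, IsStarWord s) ∧
      l.prod = wordVal Γ W ∧ l.length = n}) ⟨l.length, l, h₁, h₂, rfl⟩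
  obtain ⟨U, h₄, h₅⟩ : ∃ U, wordVal Γ U = l.prod ∧ HasStarCover Γ l.length U := by
    clear h₂ h₃
    induction l with
    | nil => exact ⟨[], by simp, HasStarCover.nil⟩
    | cons s l ih =>
      obtain ⟨U, h₂, h₃⟩ := ih fun t ht => h₁ t (List.mem_cons_of_mem _ ht)
      obtain ⟨U', h₄, h₅⟩ := (h₁ s (by simp)).exists_word
      exact ⟨U' ++ U, by simp [h₂, h₄], HasStarCover.cons h₅ h₃ (Swap.refl _)⟩
  obtain ⟨U', h₆, h₇⟩ := exists_sublist_swap_reduce (Γ := Γ) U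
  have h₈ := swap_reduce_of_wordVal_eq (h₄.trans h₂)
  rw [hW.reduce_eq] at h₈
  rw [← h₃]
  exact (h₅.sublist h₆).swap (h₇.trans h₈)

/-! ### Counting occurrences; periodic words and their prefixes. -/

open scoped Classical in
/-- The number of letters of a word that belong to the vertex `x`. -/
noncomputable def cnt (W : List (V × Bool)) (x : V) : ℕ := W.countP (fun b => b.1 = x)

section cnt

variable {U W W' : List (V × Bool)} {x y : V}

@[simp] theorem cnt_nil : cnt [] x = 0 := rfl

@[simp] theorem cnt_append : cnt (U ++ W) x = cnt U x + cnt W x := by simp [cnt]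

theorem cnt_cons (a : V × Bool) : cnt (a :: W) x = cnt [a] x + cnt W x :=
  cnt_append (U := [a])

theorem add_lt_cnt_cons (a : V × Bool) {i : ℕ} (h : i < cnt W x) :
    cnt [a] x + i < cnt (a :: W) x := by
  have := cnt_cons (W := W) (x := x) a
  omega

theorem cnt_singleton_self (a : V × Bool) : cnt [a] a.1 = 1 := by simp [cnt]

theorem cnt_singleton_of_ne {a : V × Bool} (h : a.1 ≠ x) : cnt [a] x = 0 := by simp [cnt, h]

@[simp] theorem cnt_reverse : cnt W.reverse x = cnt W x := by simp [cnt]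

theorem Swap.cnt_eq (h : Swap Γ W W') (x : V) : cnt W x = cnt W' x := h.perm.countP_eq _

theorem cnt_le_of_sublist (h : U.Sublist W) (x : V) : cnt U x ≤ cnt W x := h.countP_le

theorem cnt_pos_of_mem {b : V × Bool} (h : b ∈ W) : 0 < cnt W b.1 :=
  List.countP_pos_iff.2 ⟨b, h, by simp⟩

end cnt

/-- The concatenation of `n` copies of a word. -/
def wpow (n : ℕ) (G : List (V × Bool)) : List (V × Bool) := (List.replicate n G).flatten

section wpow

variable (n : ℕ) (G : List (V × Bool))

theorem wpow_succ : wpow (n + 1) G = G ++ wpow n G := by simp [wpow, List.replicate_succ]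

theorem wpow_succ' : wpow (n + 1) G = wpow n G ++ G := by
  simp [wpow, List.replicate_succ']

theorem wordVal_wpow : wordVal Γ (wpow n G) = wordVal Γ G ^ n := by
  induction n with
  | zero => simp [wpow]
  | succ n ih => rw [wpow_succ, wordVal_append, ih, pow_succ']

theorem cnt_wpow (x : V) : cnt (wpow n G) x = n * cnt G x := by
  induction n with
  | zero => simp [wpow]
  | succ n ih => rw [wpow_succ, cnt_append, ih]; ring

theorem length_wpow : (wpow n G).length = n * G.length := by simp [wpow]

theorem wpow_reverse : (wpow n G).reverse = wpow n G.reverse := by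
  simp [wpow, List.reverse_flatten]

end wpow

open scoped Classical in
/-- The part of a word that precedes the `i`-th occurrence (counted from zero) of the vertex `y`. -/
noncomputable def pre (y : V) : ℕ → List (V × Bool) → List (V × Bool)
  | _, [] => []
  | 0, a :: W => if a.1 = y then [] else a :: pre y 0 W
  | i + 1, a :: W => if a.1 = y then a :: pre y i W else a :: pre y (i + 1) W

section pre

variable {U W W' : List (V × Bool)} {x y : V} {i : ℕ}

theorem pre_cons_self_zero {a : V × Bool} (h : a.1 = y) : pre y 0 (a :: W) = [] := by
  simp [pre, h]

theorem pre_cons_self_succ {a : V × Bool} (h : a.1 = y) :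
    pre y (i + 1) (a :: W) = a :: pre y i W := by
  simp [pre, h]

theorem pre_cons_of_ne {a : V × Bool} (h : a.1 ≠ y) : pre y i (a :: W) = a :: pre y i W := by
  cases i <;> simp [pre, h]

theorem pre_cons_add (a : V × Bool) : pre y (cnt [a] y + i) (a :: W) = a :: pre y i W := by
  by_cases h : a.1 = y
  · subst h
    rw [cnt_singleton_self, add_comm, pre_cons_self_succ rfl]
  · rw [cnt_singleton_of_ne h, zero_add, pre_cons_of_ne h]

theorem pre_append_add : pre y (cnt U y + i) (U ++ W) = U ++ pre y i W := by
  induction U with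
  | nil => simp
  | cons a U ih => rw [cnt_cons, add_assoc, List.cons_append, pre_cons_add, ih, List.cons_append]

theorem pre_append_of_lt (h : i < cnt U y) : pre y i (U ++ W) = pre y i U := by
  induction U generalizing i with
  | nil => simp at h
  | cons a U ih =>
    by_cases ha : a.1 = y
    · cases i with
      | zero => rw [List.cons_append, pre_cons_self_zero ha, pre_cons_self_zero ha]
      | succ i =>
        subst ha
        rw [cnt_cons, cnt_singleton_self] at h
        rw [List.cons_append, pre_cons_self_succ rfl, pre_cons_self_succ rfl, ih (by omega)]
    · rw [cnt_cons, cnt_singleton_of_ne ha, zero_add] at h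
      rw [List.cons_append, pre_cons_of_ne ha, pre_cons_of_ne ha, ih h]

theorem pre_sublist : (pre y i W).Sublist W := by
  induction W generalizing i with
  | nil => exact List.Sublist.refl _
  | cons a W ih =>
    by_cases ha : a.1 = y
    · cases i with
      | zero => rw [pre_cons_self_zero ha]; exact List.nil_sublist _
      | succ i => rw [pre_cons_self_succ ha]; exact ih.cons_cons a
    · rw [pre_cons_of_ne ha]; exact ih.cons_cons a

/-- Letters at nonadjacent vertices, `x = y` included, never pass each other. -/
theorem Swap.cnt_pre (h : Swap Γ W W') (hxy : ¬ Γ.Adj x y) (i : ℕ) :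
    cnt (pre y i W) x = cnt (pre y i W') x := by
  induction h generalizing i with
  | nil => rfl
  | cons a _ ih =>
    by_cases ha : a.1 = y
    · cases i with
      | zero => rw [pre_cons_self_zero ha, pre_cons_self_zero ha]
      | succ i =>
        rw [pre_cons_self_succ ha, pre_cons_self_succ ha, cnt_cons, cnt_cons (W := pre _ _ _), ih]
    · rw [pre_cons_of_ne ha, pre_cons_of_ne ha, cnt_cons, cnt_cons (W := pre _ _ _), ih]
  | swap a b W hab =>
    by_cases ha : a.1 = y
    · have hb : b.1 ≠ y := by rintro rfl; exact Γ.irrefl (ha ▸ hab)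
      have hbx : b.1 ≠ x := by rintro rfl; exact hxy (ha ▸ hab.symm)
      cases i with
      | zero =>
        simp [pre_cons_self_zero ha, pre_cons_of_ne hb, cnt_singleton_of_ne hbx]
      | succ i =>
        rw [pre_cons_self_succ ha, pre_cons_of_ne hb, pre_cons_of_ne hb, pre_cons_self_succ ha]
        exact (Swap.swap a b _ hab).cnt_eq x
    · by_cases hb : b.1 = y
      · have hax : a.1 ≠ x := by rintro rfl; exact hxy (hb ▸ hab)
        cases i with
        | zero =>
          simp [pre_cons_self_zero hb, pre_cons_of_ne ha, cnt_singleton_of_ne hax]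
        | succ i =>
          rw [pre_cons_self_succ hb, pre_cons_of_ne ha, pre_cons_of_ne ha, pre_cons_self_succ hb]
          exact (Swap.swap a b _ hab).cnt_eq x
      · rw [pre_cons_of_ne ha, pre_cons_of_ne hb, pre_cons_of_ne hb, pre_cons_of_ne ha]
        exact (Swap.swap a b _ hab).cnt_eq x
  | trans _ _ ih ih' => exact (ih i).trans (ih' i)

/-- In a word `A G ⋯ G B`, shifting by one period inserts a copy of `G` after `A`. -/
theorem exists_pre_period {A G B : List (V × Bool)} {n : ℕ} {j : ℕ} (h : cnt A y ≤ j)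
    (h' : j + cnt G y < cnt A y + n * cnt G y) :
    ∃ D, pre y j (A ++ wpow n G ++ B) = A ++ D ∧
      pre y (j + cnt G y) (A ++ wpow n G ++ B) = A ++ G ++ D := by
  obtain ⟨i, rfl⟩ := Nat.exists_eq_add_of_le h
  cases n with
  | zero => omega
  | succ n =>
    rw [Nat.succ_mul] at h'
    have hi : i < cnt (wpow n G) y := by rw [cnt_wpow]; omega
    refine ⟨pre y i (wpow n G), ?_, ?_⟩
    · rw [List.append_assoc, pre_append_add, wpow_succ', List.append_assoc, pre_append_of_lt hi]
    · rw [List.append_assoc, add_assoc, pre_append_add, wpow_succ, List.append_assoc,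
        add_comm i, pre_append_add, pre_append_of_lt hi, List.append_assoc]

end pre

/-! ### Walls. -/

/-- The conjugate of the vertex `y` by the part of `W` before the `i`-th occurrence of `y`. -/
noncomputable def wall (Γ : SimpleGraph V) (y : V) (i : ℕ) (W : List (V × Bool)) : RAAG Γ :=
  wordVal Γ (pre y i W) * gen Γ y * (wordVal Γ (pre y i W))⁻¹

section wall

variable {W W' : List (V × Bool)} {y : V} {i : ℕ}

theorem wall_congr_cons {a : V × Bool} {j : ℕ} (h : wall Γ y i W = wall Γ y j W') :
    wordVal Γ (a :: pre y i W) * gen Γ y * (wordVal Γ (a :: pre y i W))⁻¹ =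
      wordVal Γ (a :: pre y j W') * gen Γ y * (wordVal Γ (a :: pre y j W'))⁻¹ := by
  have e : ∀ U : List (V × Bool), wordVal Γ (a :: U) * gen Γ y * (wordVal Γ (a :: U))⁻¹ =
      letterVal Γ a * (wordVal Γ U * gen Γ y * (wordVal Γ U)⁻¹) * (letterVal Γ a)⁻¹ := by
    intro U
    rw [wordVal_cons]
    group
  rw [e, e]
  exact congrArg (fun t => letterVal Γ a * t * (letterVal Γ a)⁻¹) h

/-- An exchange either leaves the value of the prefix unchanged or moves a letter commuting with `y`
across its end, which the conjugate of `y` does not see. -/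
theorem Swap.wall_eq (h : Swap Γ W W') (y : V) (i : ℕ) : wall Γ y i W = wall Γ y i W' := by
  induction h generalizing i with
  | nil => rfl
  | cons a _ ih =>
    unfold wall
    by_cases ha : a.1 = y
    · cases i with
      | zero => rw [pre_cons_self_zero ha, pre_cons_self_zero ha]
      | succ i =>
        rw [pre_cons_self_succ ha, pre_cons_self_succ ha]
        exact wall_congr_cons (ih i)
    · rw [pre_cons_of_ne ha, pre_cons_of_ne ha]
      exact wall_congr_cons (ih i)
  | swap a b W hab =>
    have key : ∀ {a b : V × Bool}, Γ.Adj a.1 b.1 → a.1 = y →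
        wall Γ y i (a :: b :: W) = wall Γ y i (b :: a :: W) := by
      intro a b hab ha
      have hb : b.1 ≠ y := by rintro rfl; exact Γ.irrefl (ha ▸ hab)
      unfold wall
      cases i with
      | zero =>
        have hc : Commute (gen Γ y) (letterVal Γ b) :=
          commute_letterVal_iff.2 (gen_commute (ha ▸ hab))
        rw [pre_cons_self_zero ha, pre_cons_of_ne hb, pre_cons_self_zero ha]
        simp [hc.symm.eq]
      | succ i =>
        rw [pre_cons_self_succ ha, pre_cons_of_ne hb, pre_cons_of_ne hb, pre_cons_self_succ ha,
          (Swap.swap a b _ hab).wordVal_eq]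
    by_cases ha : a.1 = y
    · exact key hab ha
    · by_cases hb : b.1 = y
      · exact (key hab.symm hb).symm
      · unfold wall
        rw [pre_cons_of_ne ha, pre_cons_of_ne hb, pre_cons_of_ne hb, pre_cons_of_ne ha,
          (Swap.swap a b _ hab).wordVal_eq]
  | trans _ _ ih ih' => exact (ih i).trans (ih' i)

theorem wall_period {A G B : List (V × Bool)} {n : ℕ} {j : ℕ} (h : cnt A y ≤ j)
    (h' : j + cnt G y < cnt A y + n * cnt G y) :
    wall Γ y (j + cnt G y) (A ++ wpow n G ++ B) =
      (wordVal Γ A * wordVal Γ G * (wordVal Γ A)⁻¹) * wall Γ y j (A ++ wpow n G ++ B) *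
        (wordVal Γ A * wordVal Γ G * (wordVal Γ A)⁻¹)⁻¹ := by
  obtain ⟨D, h₁, h₂⟩ := exists_pre_period (B := B) h h'
  unfold wall
  rw [h₁, h₂]
  simp only [wordVal_append]
  group

/-- An element commuting with the walls of all letters of the factor `R` of `X R E` is conjugate
by `X` to an element commuting with the letters of `R`. -/
theorem commute_of_commute_wall {X R E : List (V × Bool)} {z : RAAG Γ}
    (h : ∀ (R₁ R₂ : List (V × Bool)) (b : V × Bool), R = R₁ ++ b :: R₂ →
      Commute z (wall Γ b.1 (cnt X b.1 + cnt R₁ b.1) (X ++ R ++ E))) :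
    ∀ b ∈ R, Commute ((wordVal Γ X)⁻¹ * z * wordVal Γ X) (gen Γ b.1) := by
  set z' := (wordVal Γ X)⁻¹ * z * wordVal Γ X with hz'
  -- The wall of `b` is its vertex conjugated by `X R₁`. Once `z'` commutes with `R₁`, the
  -- conjugation by `R₁` drops out, so `R` can be treated letter by letter.
  have key : ∀ (R₁ R₂ : List (V × Bool)) (b : V × Bool), R = R₁ ++ b :: R₂ →
      Commute z' (wordVal Γ R₁) → Commute z' (gen Γ b.1) := by
    intro R₁ R₂ b hR hc
    have h₁ := h R₁ R₂ b hR
    have h₂ : pre b.1 (cnt X b.1 + cnt R₁ b.1) (X ++ R ++ E) = X ++ R₁ := by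
      rw [hR, List.append_assoc, pre_append_add, List.append_assoc]
      have := pre_append_add (y := b.1) (i := 0) (U := R₁) (W := b :: R₂ ++ E)
      rw [add_zero] at this
      rw [this, List.cons_append, pre_cons_self_zero rfl, List.append_nil]
    unfold wall at h₁
    rw [h₂, wordVal_append] at h₁
    set X' := wordVal Γ X
    set R' := wordVal Γ R₁
    have h₃ : Commute ((X' * R')⁻¹ * z * (X' * R')) (gen Γ b.1) := by
      have h₄ := congrArg (fun t => (X' * R')⁻¹ * t * (X' * R')) h₁.eq
      change _ = _
      convert h₄ using 1 <;> group
    have h₄ : (X' * R')⁻¹ * z * (X' * R') = z' := by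
      have : (X' * R')⁻¹ * z * (X' * R') = R'⁻¹ * (z' * R') := by rw [hz']; group
      rw [this, hc.eq, inv_mul_cancel_left]
    rwa [h₄] at h₃
  have key' : ∀ (R₁ R₂ : List (V × Bool)), R = R₁ ++ R₂ → Commute z' (wordVal Γ R₁) := by
    intro R₁
    induction R₁ using List.reverseRecOn with
    | nil => intro _ _; exact Commute.one_right _
    | append_singleton R₁ b ih =>
      intro R₂ hR
      have hR' : R = R₁ ++ b :: R₂ := by rw [hR]; simp
      have h₁ := ih _ hR'
      rw [wordVal_append]
      refine h₁.mul_right ?_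
      simpa using commute_letterVal_iff.2 (key R₁ R₂ b hR' h₁)
  intro b hb
  obtain ⟨R₁, R₂, hR⟩ := List.append_of_mem hb
  exact key R₁ R₂ b hR (key' R₁ _ hR)

/-- Any letter of a reduced word of `z` serves as the centre: it lies in the star of each letter of
`R`. -/
theorem inStar_of_commute {R : List (V × Bool)} {z : RAAG Γ} (hz : z ≠ 1)
    (h : ∀ b ∈ R, Commute z (gen Γ b.1)) : InStar Γ R := by
  obtain ⟨W, rfl, hW⟩ := exists_geodesic z
  cases W with
  | nil => exact absurd rfl hz
  | cons y W =>
    refine ⟨y.1, fun b hb => ?_⟩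
    rcases (isReduced_of_geodesic hW).mem_star_of_commute (h b hb).symm y (by simp) with h | h
    · exact Or.inl h.symm
    · exact Or.inr h.symm

end wall

/-! ### Selecting letters by occurrence number; ideals. -/

open scoped Classical in
/-- The subword of those letters whose vertex `x` and occurrence number `i` satisfy `S x i`. -/
noncomputable def sel : (V → ℕ → Prop) → List (V × Bool) → List (V × Bool)
  | _, [] => []
  | S, a :: W => (if S a.1 0 then [a] else []) ++ sel (fun x i => S x (cnt [a] x + i)) W

section sel

variable {S S' : V → ℕ → Prop} {U W W' : List (V × Bool)} {x : V}

@[simp] theorem sel_nil : sel S [] = [] := rfl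

theorem sel_cons_of_pos {a : V × Bool} (h : S a.1 0) :
    sel S (a :: W) = a :: sel (fun x i => S x (cnt [a] x + i)) W := by simp [sel, h]

theorem sel_cons_of_neg {a : V × Bool} (h : ¬ S a.1 0) :
    sel S (a :: W) = sel (fun x i => S x (cnt [a] x + i)) W := by simp [sel, h]

theorem sel_append : sel S (U ++ W) = sel S U ++ sel (fun x i => S x (cnt U x + i)) W := by
  induction U generalizing S with
  | nil => simp
  | cons a U ih =>
    have e : (fun x i => S x (cnt (a :: U) x + i)) =
        fun x i => S x (cnt [a] x + (cnt U x + i)) := by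
      funext x i
      rw [cnt_cons, add_assoc]
    rw [e, List.cons_append]
    by_cases h : S a.1 0
    · rw [sel_cons_of_pos h, sel_cons_of_pos h, ih, List.cons_append]
    · rw [sel_cons_of_neg h, sel_cons_of_neg h, ih]

theorem sel_sublist : (sel S W).Sublist W := by
  induction W generalizing S with
  | nil => exact List.Sublist.refl _
  | cons a W ih =>
    by_cases h : S a.1 0
    · rw [sel_cons_of_pos h]; exact ih.cons_cons a
    · rw [sel_cons_of_neg h]; exact ih.cons a

theorem sel_sublist_sel (h : ∀ x i, i < cnt W x → S x i → S' x i) :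
    (sel S W).Sublist (sel S' W) := by
  induction W generalizing S S' with
  | nil => exact List.Sublist.refl _
  | cons a W ih =>
    have h₁ : (sel (fun x i => S x (cnt [a] x + i)) W).Sublist
        (sel (fun x i => S' x (cnt [a] x + i)) W) :=
      ih fun x i hi => h x _ (add_lt_cnt_cons a hi)
    by_cases hs : S a.1 0
    · have hs' := h a.1 0 (cnt_pos_of_mem (by simp)) hs
      rw [sel_cons_of_pos hs, sel_cons_of_pos hs']
      exact h₁.cons_cons a
    · rw [sel_cons_of_neg hs]
      by_cases hs' : S' a.1 0
      · rw [sel_cons_of_pos hs']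
        exact h₁.cons a
      · rwa [sel_cons_of_neg hs']

theorem sel_congr (h : ∀ x i, i < cnt W x → (S x i ↔ S' x i)) : sel S W = sel S' W :=
  (sel_sublist_sel fun x i hi => (h x i hi).1).antisymm
    (sel_sublist_sel fun x i hi => (h x i hi).2)

theorem sel_eq_self (h : ∀ x i, i < cnt W x → S x i) : sel S W = W := by
  induction W generalizing S with
  | nil => rfl
  | cons a W ih =>
    rw [sel_cons_of_pos (h a.1 0 (cnt_pos_of_mem (by simp))),
      ih fun x i hi => h x _ (add_lt_cnt_cons a hi)]

theorem sel_eq_nil (h : ∀ x i, i < cnt W x → ¬ S x i) : sel S W = [] := by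
  induction W generalizing S with
  | nil => rfl
  | cons a W ih =>
    rw [sel_cons_of_neg (h a.1 0 (cnt_pos_of_mem (by simp))),
      ih fun x i hi => h x _ (add_lt_cnt_cons a hi)]

/-- Letters of the same vertex are never exchanged, so each letter keeps its occurrence number. -/
theorem Swap.sel (h : Swap Γ W W') (S : V → ℕ → Prop) : Swap Γ (sel S W) (sel S W') := by
  induction h generalizing S with
  | nil => exact nil
  | cons a _ ih =>
    by_cases hs : S a.1 0
    · rw [sel_cons_of_pos hs, sel_cons_of_pos hs]; exact (ih _).cons a
    · rw [sel_cons_of_neg hs, sel_cons_of_neg hs]; exact ih _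
  | swap a b W hab =>
    have h₁ : RAAG.sel (fun x i => S x (cnt [a] x + i)) [b] = RAAG.sel S [b] := by
      refine sel_congr fun x i hi => ?_
      by_cases hx : b.1 = x
      · subst hx
        rw [cnt_singleton_of_ne (a := a) (x := b.1) hab.ne, zero_add]
      · rw [cnt_singleton_of_ne hx] at hi
        omega
    have h₂ : RAAG.sel (fun x i => S x (cnt [b] x + i)) [a] = RAAG.sel S [a] := by
      refine sel_congr fun x i hi => ?_
      by_cases hx : a.1 = x
      · subst hx
        rw [cnt_singleton_of_ne (a := b) (x := a.1) hab.ne', zero_add]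
      · rw [cnt_singleton_of_ne hx] at hi
        omega
    have h₃ : Swap Γ (RAAG.sel S [a] ++ RAAG.sel S [b]) (RAAG.sel S [b] ++ RAAG.sel S [a]) := by
      refine append_comm fun c hc d hd => ?_
      have hc' := List.mem_singleton.1 (sel_sublist.subset hc)
      have hd' := List.mem_singleton.1 (sel_sublist.subset hd)
      rw [hc', hd']
      exact hab
    have h₄ : RAAG.sel S ([a] ++ [b] ++ W) = RAAG.sel S [a] ++ RAAG.sel S [b] ++
        RAAG.sel (fun x i => S x (cnt ([a] ++ [b]) x + i)) W := by
      rw [sel_append, sel_append, h₁]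
    have h₅ : RAAG.sel S ([b] ++ [a] ++ W) = RAAG.sel S [b] ++ RAAG.sel S [a] ++
        RAAG.sel (fun x i => S x (cnt ([a] ++ [b]) x + i)) W := by
      rw [sel_append, sel_append, h₂]
      simp only [cnt_append, add_comm (cnt [a] _)]
    change Swap Γ (RAAG.sel S ([a] ++ [b] ++ W)) (RAAG.sel S ([b] ++ [a] ++ W))
    rw [h₄, h₅]
    exact h₃.append_right _
  | trans _ _ ih ih' => exact (ih S).trans (ih' S)

theorem cnt_sel_add (S : V → ℕ → Prop) (W : List (V × Bool)) (x : V) :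
    cnt (sel S W) x + cnt (sel (fun x i => ¬ S x i) W) x = cnt W x := by
  induction W generalizing S with
  | nil => rfl
  | cons a W ih =>
    have := ih (fun x i => S x (cnt [a] x + i))
    by_cases hs : S a.1 0
    · rw [sel_cons_of_pos hs, sel_cons_of_neg (by simpa using hs), cnt_cons,
        cnt_cons (W := W)]
      omega
    · rw [sel_cons_of_neg hs, sel_cons_of_pos (by simpa using hs), cnt_cons (W := sel _ _),
        cnt_cons (W := W)]
      omega

theorem cnt_sel_lt (c : V → ℕ) (W : List (V × Bool)) (x : V) :
    cnt (sel (fun x i => i < c x) W) x = min (c x) (cnt W x) := by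
  induction W generalizing c with
  | nil => simp
  | cons a W ih =>
    have e : (fun x i => cnt [a] x + i < c x) = fun x i => i < c x - cnt [a] x := by
      funext x i
      exact propext (by omega)
    have h := ih (fun x => c x - cnt [a] x)
    by_cases hs : 0 < c a.1
    · rw [sel_cons_of_pos hs, cnt_cons, cnt_cons (W := W), e, h]
      by_cases hx : a.1 = x
      · subst hx
        rw [cnt_singleton_self]
        omega
      · rw [cnt_singleton_of_ne hx]
        omega
    · rw [sel_cons_of_neg hs, cnt_cons (W := W), e, h]
      by_cases hx : a.1 = x
      · subst hx
        omega
      · rw [cnt_singleton_of_ne hx]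
        omega

theorem exists_of_mem_sel {b : V × Bool} (h : b ∈ sel S W) : ∃ j < cnt W b.1, S b.1 j := by
  induction W generalizing S with
  | nil => simp at h
  | cons a W ih =>
    have tail : b ∈ sel (fun x i => S x (cnt [a] x + i)) W →
        ∃ j < cnt (a :: W) b.1, S b.1 j := by
      intro hb
      obtain ⟨j, h₁, h₂⟩ := ih hb
      exact ⟨_, add_lt_cnt_cons a h₁, h₂⟩
    by_cases hs : S a.1 0
    · rw [sel_cons_of_pos hs] at h
      rcases List.mem_cons.1 h with rfl | h
      · exact ⟨0, cnt_pos_of_mem (by simp), hs⟩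
      · exact tail h
    · rw [sel_cons_of_neg hs] at h
      exact tail h

end sel

/-- A set of letters of `W` that contains with a letter all earlier letters not commuting with
it. -/
def IsIdeal (Γ : SimpleGraph V) (W : List (V × Bool)) (S : V → ℕ → Prop) : Prop :=
  ∀ x y, ¬ Γ.Adj x y → ∀ j < cnt W y, S y j → ∀ i < cnt (pre y j W) x, S x i

section ideal

variable {S S' : V → ℕ → Prop} {U W W' : List (V × Bool)}

theorem IsIdeal.swap (h : IsIdeal Γ W S) (hs : Swap Γ W W') : IsIdeal Γ W' S := by
  intro x y hxy j hj hS i hi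
  rw [← hs.cnt_eq] at hj
  rw [← hs.cnt_pre hxy] at hi
  exact h x y hxy j hj hS i hi

theorem isIdeal_append_left (Γ : SimpleGraph V) (U W : List (V × Bool)) :
    IsIdeal Γ (U ++ W) fun x i => i < cnt U x := by
  intro x y _ j _ hS i hi
  rw [pre_append_of_lt hS] at hi
  exact hi.trans_le (cnt_le_of_sublist pre_sublist x)

/-- The letters of an ideal can be moved to the front. -/
theorem IsIdeal.swap_sel (h : IsIdeal Γ W S) :
    Swap Γ W (sel S W ++ sel (fun x i => ¬ S x i) W) := by
  induction W generalizing S with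
  | nil => exact Swap.nil
  | cons a W ih =>
    have h₁ : IsIdeal Γ W fun x i => S x (cnt [a] x + i) := by
      intro x y hxy j hj hS i hi
      refine h x y hxy _ (add_lt_cnt_cons a hj) hS _ ?_
      rw [pre_cons_add]
      exact add_lt_cnt_cons a hi
    by_cases hs : S a.1 0
    · rw [sel_cons_of_pos hs, sel_cons_of_neg (by simpa using hs)]
      exact (ih h₁).cons a
    · rw [sel_cons_of_neg hs, sel_cons_of_pos (by simpa using hs)]
      refine ((ih h₁).cons a).trans (Swap.cons_append a _ fun b hb => ?_)
      by_contra hab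
      obtain ⟨j, h₂, h₃⟩ := exists_of_mem_sel hb
      refine hs (h a.1 b.1 hab _ (add_lt_cnt_cons a h₂) h₃ 0 ?_)
      rw [pre_cons_add]
      exact cnt_pos_of_mem (by simp)

end ideal

/-! ### Cutting off the ends of a word with two periodic decompositions. -/

/-- The number of letters of vertex `x` in the smallest initial part that contains the prefixes
`A'` and `A` of a word `A G ⋯ G B`, and the translate of `A'` by one period. -/
noncomputable def leftCut (A' A G : List (V × Bool)) (n : ℕ) (x : V) : ℕ :=
  max (max (cnt A' x) (cnt A x))
    (min (max (cnt A' x) (cnt A x) + cnt G x) (cnt A x + n * cnt G x))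

section leftCut

variable {A' C A G B : List (V × Bool)} {n : ℕ}

/-- Prefixes are ideals, which settles letters of `A'`, `A` and the first `G`. Any other letter of
the cut lies one period after a letter of `A'`, and the ideal property of `A'` is carried over by
periodicity. -/
theorem isIdeal_leftCut (hn : 1 ≤ n) (h : Swap Γ (A' ++ C) (A ++ wpow n G ++ B)) :
    IsIdeal Γ (A ++ wpow n G ++ B) fun x i => i < leftCut A' A G n x := by
  have h₁ := (isIdeal_append_left Γ A' C).swap h
  have h₂ : IsIdeal Γ (A ++ wpow n G ++ B) fun x i => i < cnt A x := by
    rw [List.append_assoc]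
    exact isIdeal_append_left Γ A _
  intro x y hxy j hj hS i hi
  have hmul : ∀ z, cnt G z ≤ n * cnt G z := fun z => Nat.le_mul_of_pos_left _ hn
  have hGx := hmul x
  unfold leftCut at hS ⊢
  by_cases hj₁ : j < cnt A' y
  · have := h₁ x y hxy j hj hj₁ i hi
    simp only at this
    omega
  by_cases hj₂ : j < cnt A y
  · have := h₂ x y hxy j hj hj₂ i hi
    simp only at this
    omega
  have hjn : j < cnt A y + n * cnt G y := by omega
  have hin : i < cnt A x + n * cnt G x := by
    rw [pre_append_of_lt (by simpa [cnt_wpow] using hjn)] at hi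
    have := hi.trans_le (cnt_le_of_sublist pre_sublist x)
    simpa [cnt_wpow] using this
  by_cases hj₃ : j < cnt A y + cnt G y
  · obtain ⟨m, rfl⟩ := Nat.exists_eq_add_of_le' hn
    have e : A ++ wpow (m + 1) G ++ B = (A ++ G) ++ (wpow m G ++ B) := by
      rw [wpow_succ]; simp
    rw [e, pre_append_of_lt (by simpa using hj₃)] at hi
    have := hi.trans_le (cnt_le_of_sublist pre_sublist x)
    rw [cnt_append] at this
    omega
  · obtain ⟨j', rfl⟩ : ∃ j', j = j' + cnt G y := ⟨j - cnt G y, by omega⟩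
    obtain ⟨D, hD₁, hD₂⟩ := exists_pre_period (A := A) (B := B) (by omega) hjn
    rw [hD₂] at hi
    simp only [cnt_append] at hi
    by_cases hi' : i < cnt G x
    · omega
    · have := h₁ x y hxy j' (by omega) (by simp only; omega) (i - cnt G x)
        (by rw [hD₁, cnt_append]; omega)
      simp only at this
      omega

theorem hasStarCover_leftCut (hn : 1 ≤ n) (h : Swap Γ (A' ++ C) (A ++ wpow n G ++ B))
    {k' k l : ℕ} (hA' : HasStarCover Γ k' A') (hA : HasStarCover Γ k A)
    (hG : HasStarCover Γ l G) :
    HasStarCover Γ (k + l + k')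
      (sel (fun x i => i < leftCut A' A G n x) (A ++ wpow n G ++ B)) := by
  obtain ⟨m, rfl⟩ := Nat.exists_eq_add_of_le' hn
  have h₁ : HasStarCover Γ k' (sel (fun x i => i < cnt A' x) (A ++ wpow (m + 1) G ++ B)) := by
    refine HasStarCover.swap ?_ (h.sel _)
    rw [sel_append, sel_eq_self fun x i hi => hi, sel_eq_nil fun x i hi => by omega]
    simpa using hA'
  have e₁ : A ++ wpow (m + 1) G ++ B = A ++ G ++ (wpow m G ++ B) := by
    rw [wpow_succ]; simp
  have e₂ : A ++ wpow (m + 1) G ++ B = A ++ (wpow m G ++ (G ++ B)) := by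
    rw [wpow_succ']; simp
  have e₃ : A ++ wpow (m + 1) G ++ B = A ++ G ++ wpow m G ++ B := by
    rw [e₁]; simp
  rw [e₃, sel_append, sel_append, sel_append, List.append_assoc]
  refine ((hA.sublist sel_sublist).append (hG.sublist sel_sublist)).append (h₁.sublist ?_)
  -- Writing the last copy of `G` separately compares each letter of the cut in the later periods
  -- with the letter one period earlier, which belongs to `A'`.
  rw [e₂, sel_append, sel_append, sel_append]
  refine List.Sublist.trans (List.Sublist.append ?_ ?_) (List.sublist_append_right _ _)
  · refine sel_sublist_sel fun x i hi hS => ?_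
    unfold leftCut at hS
    simp only [cnt_append] at hS
    omega
  · refine List.Sublist.trans ?_ (List.sublist_append_right _ _)
    refine sel_sublist_sel fun x i hi hS => ?_
    unfold leftCut at hS
    simp only [cnt_append, cnt_wpow, Nat.succ_mul] at hS ⊢
    omega

end leftCut

/-- Two periodic decompositions of a word cut it into an initial and a final part of bounded star
length, and a middle part whose letters can be moved within both periodic ranges. -/
theorem exists_middle {A₁ G₁ B₁ A₂ G₂ B₂ : List (V × Bool)} {n₁ n₂ : ℕ} (hn₁ : 1 ≤ n₁)
    (hn₂ : 1 ≤ n₂) (h : Swap Γ (A₁ ++ wpow n₁ G₁ ++ B₁) (A₂ ++ wpow n₂ G₂ ++ B₂))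
    {a₁ g₁ b₁ a₂ g₂ b₂ : ℕ} (hA₁ : HasStarCover Γ a₁ A₁) (hG₁ : HasStarCover Γ g₁ G₁)
    (hB₁ : HasStarCover Γ b₁ B₁) (hA₂ : HasStarCover Γ a₂ A₂) (hG₂ : HasStarCover Γ g₂ G₂)
    (hB₂ : HasStarCover Γ b₂ B₂) :
    ∃ X R E : List (V × Bool), Swap Γ (A₁ ++ wpow n₁ G₁ ++ B₁) (X ++ R ++ E) ∧
      HasStarCover Γ (a₂ + g₂ + a₁) X ∧ HasStarCover Γ (b₁ + g₁ + b₂) E ∧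
      ∀ (R₁ R₂ : List (V × Bool)) (b : V × Bool), R = R₁ ++ b :: R₂ →
        max (cnt A₁ b.1) (cnt A₂ b.1) + cnt G₂ b.1 ≤ cnt X b.1 + cnt R₁ b.1 ∧
        cnt X b.1 + cnt R₁ b.1 + cnt G₁ b.1 + max (cnt B₁ b.1) (cnt B₂ b.1) <
          cnt (A₁ ++ wpow n₁ G₁ ++ B₁) b.1 := by
  set W₁ := A₁ ++ wpow n₁ G₁ ++ B₁ with hW₁
  set W₂ := A₂ ++ wpow n₂ G₂ ++ B₂ with hW₂
  have hl : Swap Γ (A₁ ++ (wpow n₁ G₁ ++ B₁)) W₂ := by rwa [← List.append_assoc]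
  -- The right cut is a left cut of the reversed words with the decompositions interchanged, so the
  -- margin is a period `G₂` on the left and a period `G₁` on the right.
  have hr : Swap Γ (B₂.reverse ++ (wpow n₂ G₂.reverse ++ A₂.reverse))
      (B₁.reverse ++ wpow n₁ G₁.reverse ++ A₁.reverse) := by
    have := h.symm.reverse
    simpa [hW₁, hW₂, wpow_reverse] using this
  have hW₁r : B₁.reverse ++ wpow n₁ G₁.reverse ++ A₁.reverse = W₁.reverse := by
    simp [hW₁, wpow_reverse]
  set c := leftCut A₁ A₂ G₂ n₂ with hc
  set e := leftCut B₂.reverse B₁.reverse G₁.reverse n₁ with he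
  have hl₁ := (isIdeal_leftCut hn₂ hl).swap_sel
  have hl₂ := hasStarCover_leftCut hn₂ hl hA₁ hA₂ hG₂
  have hr₁ := (isIdeal_leftCut hn₁ hr).swap_sel.reverse
  have hr₂ := (hasStarCover_leftCut hn₁ hr hB₂.reverse hB₁.reverse hG₁.reverse).reverse
  rw [hW₁r] at hr₁ hr₂
  rw [← he] at hr₁ hr₂
  rw [← hW₂, ← hc] at hl₁ hl₂
  rw [List.reverse_reverse, List.reverse_append] at hr₁
  set Z := (sel (fun x i => ¬ i < e x) W₁.reverse).reverse with hZ
  set E := (sel (fun x i => i < e x) W₁.reverse).reverse with hE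
  set X := sel (fun x i => i < c x) W₂ with hX
  have hsplit := (h.symm.trans hr₁).sel (fun x i => ¬ i < c x)
  rw [sel_append (U := Z)] at hsplit
  set R := sel (fun x i => ¬ i < c x) Z with hR
  refine ⟨X, R, sel (fun x i => ¬ cnt Z x + i < c x) E, ?_, hl₂, hr₂.sublist sel_sublist, ?_⟩
  · rw [List.append_assoc]
    exact h.trans (hl₁.trans (hsplit.append_left X))
  · intro R₁ R₂ b hb
    have hN := h.cnt_eq b.1
    have hX' : cnt X b.1 = min (c b.1) (cnt W₂ b.1) := cnt_sel_lt c W₂ b.1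
    have hE' : cnt E b.1 = min (e b.1) (cnt W₁ b.1) := by
      rw [hE, cnt_reverse, cnt_sel_lt, cnt_reverse]
    have hZE : cnt W₁ b.1 = cnt Z b.1 + cnt E b.1 := by rw [hr₁.cnt_eq, cnt_append]
    have hR' : min (c b.1) (cnt Z b.1) + cnt R b.1 = cnt Z b.1 := by
      rw [← cnt_sel_lt c Z b.1]
      exact cnt_sel_add (fun x i => i < c x) Z b.1
    have hRb : cnt R b.1 = cnt R₁ b.1 + (1 + cnt R₂ b.1) := by
      rw [hb, cnt_append, cnt_cons, cnt_singleton_self]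
    have hN₁ : cnt W₁ b.1 = cnt A₁ b.1 + n₁ * cnt G₁ b.1 + cnt B₁ b.1 := by
      rw [hW₁, cnt_append, cnt_append, cnt_wpow]
    have hN₂ : cnt W₂ b.1 = cnt A₂ b.1 + n₂ * cnt G₂ b.1 + cnt B₂ b.1 := by
      rw [hW₂, cnt_append, cnt_append, cnt_wpow]
    have hcb : c b.1 = max (max (cnt A₁ b.1) (cnt A₂ b.1))
        (min (max (cnt A₁ b.1) (cnt A₂ b.1) + cnt G₂ b.1)
          (cnt A₂ b.1 + n₂ * cnt G₂ b.1)) := rfl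
    have heb : e b.1 = max (max (cnt B₂ b.1) (cnt B₁ b.1))
        (min (max (cnt B₂ b.1) (cnt B₁ b.1) + cnt G₁ b.1)
          (cnt B₁ b.1 + n₁ * cnt G₁ b.1)) := by
      rw [he]
      simp only [leftCut, cnt_reverse]
    -- The caps in `c` and `e` do no harm: a letter of `R` comes before the final `B₂` and after the
    -- initial `A₁`, so the uncapped bounds hold for it.
    omega

/-! ### Shifts with two periods, and common roots. -/

/-- If two commuting maps shift a sequence on a window by `p` and by `q`, and the window has
length at least `p + q`, then iterates with the same total shift agree on the window. -/
theorem iterate_eq_of_shift {α : Type*} {a b : α → α} (hab : Function.Commute a b) {T : ℕ → α}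
    {s e p q : ℕ} (hp : 0 < p) (hlen : s + p + q ≤ e)
    (ha : ∀ j, s ≤ j → j + p < e → T (j + p) = a (T j))
    (hb : ∀ j, s ≤ j → j + q < e → T (j + q) = b (T j)) {m n : ℕ} (hmn : m * p = n * q)
    {j : ℕ} (hj : s ≤ j) (hj' : j < e) : a^[m] (T j) = b^[n] (T j) := by
  -- `F` extends the first `p` values of `T` to all of `ℕ` by the rule for `a`, so iterates may
  -- leave the window.
  set F : ℕ → α := fun k => a^[k / p] (T (s + k % p)) with hF
  have hFa : ∀ i k, F (k + i * p) = a^[i] (F k) := by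
    intro i k
    simp only [hF]
    rw [Nat.add_mul_div_right _ _ hp, Nat.add_mul_mod_self_right, add_comm,
      Function.iterate_add_apply]
  have hFT : ∀ k, s + k < e → F k = T (s + k) := by
    intro k
    induction k using Nat.strong_induction_on with
    | _ k ih =>
      intro hk
      by_cases hkp : k < p
      · simp [hF, Nat.div_eq_of_lt hkp, Nat.mod_eq_of_lt hkp]
      · obtain ⟨i, rfl⟩ : ∃ i, k = i + p := ⟨k - p, by omega⟩
        have := hFa 1 i
        rw [one_mul] at this
        rw [this, Function.iterate_one, ih i (by omega) (by omega), ← add_assoc,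
          ha _ (by omega) (by omega)]
  -- Only `k % p + q < p + q` has to lie in the window; commuting with `a` gives the rest.
  have hFb₁ : ∀ k, F (k + q) = b (F k) := by
    intro k
    have hρ := Nat.mod_lt k hp
    have e₁ : k + q = (k % p + q) + k / p * p := by
      have := Nat.mod_add_div k p
      rw [mul_comm] at this
      omega
    rw [e₁, hFa, hFT _ (by omega), ← add_assoc, hb _ (by omega) (by omega)]
    exact (hab.iterate_left (k / p)) _
  have hFb : ∀ i k, F (k + i * q) = b^[i] (F k) := by
    intro i k
    induction i with
    | zero => simp
    | succ i ih => rw [Nat.succ_mul, ← add_assoc, hFb₁, ih, Function.iterate_succ_apply']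
  obtain ⟨k, rfl⟩ := Nat.exists_eq_add_of_le hj
  rw [← hFT k hj', ← hFa, ← hFb, hmn]

theorem iterate_conj {G : Type*} [Group G] (u t : G) (m : ℕ) :
    (fun t => u * t * u⁻¹)^[m] t = u ^ m * t * (u ^ m)⁻¹ := by
  induction m with
  | zero => simp
  | succ m ih =>
    rw [Function.iterate_succ_apply', ih, pow_succ']
    group

/-- Commuting elements with equal coprime powers are powers of a common element. -/
theorem exists_common_root {G : Type*} [Group G] {u v : G} (huv : Commute u v) {p q : ℕ}
    (hpq : Nat.Coprime p q) (h : u ^ q = v ^ p) : ∃ k : G, u = k ^ p ∧ v = k ^ q := by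
  have hbez : (p : ℤ) * p.gcdA q + q * p.gcdB q = 1 := by
    rw [← Nat.gcd_eq_gcd_ab, hpq]
    rfl
  set s := p.gcdA q
  set t := p.gcdB q
  have h' : u ^ (q : ℤ) = v ^ (p : ℤ) := by simpa using h
  have hc : Commute (u ^ s) (v ^ t) := huv.zpow_zpow s t
  -- With `p * s + q * t = 1`, the `p`-th power is `u ^ (s * p) * v ^ (t * p) = u ^ (s * p + t * q)
  -- = u`, and similarly for `v`.
  refine ⟨u ^ s * v ^ t, ?_, ?_⟩
  · rw [hc.mul_pow, ← zpow_natCast, ← zpow_natCast, ← zpow_mul, ← zpow_mul, mul_comm t,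
      zpow_mul v, ← h', ← zpow_mul, ← zpow_add, mul_comm s, hbez, zpow_one]
  · rw [hc.mul_pow, ← zpow_natCast, ← zpow_natCast, ← zpow_mul, ← zpow_mul, mul_comm s,
      zpow_mul u, h', ← zpow_mul, ← zpow_add, mul_comm t, hbez, zpow_one]

theorem IsPrimitive.conj {g : RAAG Γ} (h : IsPrimitive g) (a : RAAG Γ) :
    IsPrimitive (a * g * a⁻¹) := by
  refine ⟨fun he => h.1 (by simpa using he), fun k n hn he => h.2 (a⁻¹ * k * a) n hn ?_⟩
  have := conj_pow (i := n) (a := a⁻¹) (b := k)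
  rw [inv_inv] at this
  rw [this, ← he]
  group

/-- A word whose vertices fall into two nonempty mutually adjacent sets is covered by two
stars. -/
theorem hasStarCover_two {R : List (V × Bool)} (P : V → Prop) {b c : V × Bool} (hb : b ∈ R)
    (hc : c ∈ R) (hPb : P b.1) (hPc : ¬ P c.1)
    (h : ∀ a ∈ R, ∀ d ∈ R, P a.1 → ¬ P d.1 → Γ.Adj a.1 d.1) : HasStarCover Γ 2 R := by
  classical
  have hs : ∀ R' : List (V × Bool), R'.Sublist R →
      Swap Γ R' (R'.filter (fun a => P a.1) ++ R'.filter (fun a => ¬ P a.1)) := by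
    intro R'
    induction R' with
    | nil => intro _; exact Swap.nil
    | cons a R' ih =>
      intro hR'
      have ih := ih ((List.sublist_cons_self a R').trans hR')
      by_cases ha : P a.1
      · simpa [List.filter_cons, ha] using ih.cons a
      · have h₁ := (ih.cons a).trans
          (Swap.cons_append a (R'.filter (fun a => ¬ P a.1))
            (U := R'.filter (fun a => P a.1)) fun d hd => ?_)
        · simpa [List.filter_cons, ha] using h₁
        · have hd' := List.mem_filter.1 hd
          exact (h d (hR'.subset (List.mem_cons_of_mem _ hd'.1)) a (hR'.subset (by simp))
            (by simpa using hd'.2) ha).symm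
  refine HasStarCover.swap (HasStarCover.append (k := 1) (l := 1) (HasStarCover.of_inStar ?_)
    (HasStarCover.of_inStar ?_)) (hs R (List.Sublist.refl R)).symm
  · refine ⟨c.1, fun a ha => Or.inr ?_⟩
    have ha' := List.mem_filter.1 ha
    exact (h a ha'.1 c hc (by simpa using ha'.2) hPc).symm
  · refine ⟨b.1, fun a ha => Or.inr ?_⟩
    have ha' := List.mem_filter.1 ha
    exact h b hb a ha'.1 hPb (by simpa using ha'.2)

/-! ### Comparison of the two decompositions. -/

/-- Two primitive periodic decompositions of a reduced word have the same axis element, provided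
that the word has large star length. -/
theorem conj_eq_of_swap {A₁ G₁ B₁ A₂ G₂ B₂ : List (V × Bool)} {n₁ n₂ : ℕ} (hn₁ : 1 ≤ n₁)
    (hn₂ : 1 ≤ n₂) (h : Swap Γ (A₁ ++ wpow n₁ G₁ ++ B₁) (A₂ ++ wpow n₂ G₂ ++ B₂))
    (hp₁ : IsPrimitive (wordVal Γ G₁)) (hp₂ : IsPrimitive (wordVal Γ G₂))
    {a₁ g₁ b₁ a₂ g₂ b₂ : ℕ} (hA₁ : HasStarCover Γ a₁ A₁) (hG₁ : HasStarCover Γ g₁ G₁)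
    (hB₁ : HasStarCover Γ b₁ B₁) (hA₂ : HasStarCover Γ a₂ A₂) (hG₂ : HasStarCover Γ g₂ G₂)
    (hB₂ : HasStarCover Γ b₂ B₂)
    (hstar : a₁ + a₂ + g₁ + g₂ + b₁ + b₂ + 2 < starLength (wordVal Γ (A₁ ++ wpow n₁ G₁ ++ B₁))) :
    wordVal Γ A₁ * wordVal Γ G₁ * (wordVal Γ A₁)⁻¹ =
      wordVal Γ A₂ * wordVal Γ G₂ * (wordVal Γ A₂)⁻¹ := by
  obtain ⟨X, R, E, hsw, hX, hE, hmid⟩ := exists_middle hn₁ hn₂ h hA₁ hG₁ hB₁ hA₂ hG₂ hB₂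
  have hp₁' := hp₁.conj (wordVal Γ A₁)
  have hp₂' := hp₂.conj (wordVal Γ A₂)
  have hwall₁ := fun y j => @wall_period V Γ y A₁ G₁ B₁ n₁ j
  have hwall₂ := fun y j => @wall_period V Γ y A₂ G₂ B₂ n₂ j
  have hpre₁ := fun y j => @exists_pre_period V y A₁ G₁ B₁ n₁ j
  have hpre₂ := fun y j => @exists_pre_period V y A₂ G₂ B₂ n₂ j
  set u := wordVal Γ A₁ * wordVal Γ G₁ * (wordVal Γ A₁)⁻¹
  set v := wordVal Γ A₂ * wordVal Γ G₂ * (wordVal Γ A₂)⁻¹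
  set W₁ := A₁ ++ wpow n₁ G₁ ++ B₁ with hW₁
  set W₂ := A₂ ++ wpow n₂ G₂ ++ B₂ with hW₂
  -- The covers of `X` and `E` use up everything in `hstar` except the summand 2.
  have hR : ∀ k, k ≤ 2 → ¬ HasStarCover Γ k R := by
    intro k hk hc
    have := (((hX.append hc).append hE).swap hsw.symm).starLength_le
    omega
  have hcnt₁ : ∀ y, cnt W₁ y = cnt A₁ y + n₁ * cnt G₁ y + cnt B₁ y := fun y => by
    rw [hW₁, cnt_append, cnt_append, cnt_wpow]
  have hcnt₂ : ∀ y, cnt W₁ y = cnt A₂ y + n₂ * cnt G₂ y + cnt B₂ y := fun y => by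
    rw [h.cnt_eq, hW₂, cnt_append, cnt_append, cnt_wpow]
  set s : V → ℕ := fun y => max (cnt A₁ y) (cnt A₂ y) with hs
  set e : V → ℕ := fun y => cnt W₁ y - max (cnt B₁ y) (cnt B₂ y) with he
  have hu : ∀ y j, s y ≤ j → j + cnt G₁ y < e y →
      wall Γ y (j + cnt G₁ y) W₁ = u * wall Γ y j W₁ * u⁻¹ := by
    intro y j hj hj'
    have := hcnt₁ y
    simp only [hs, he] at hj hj'
    exact hwall₁ y j (by omega) (by omega)
  have hv : ∀ y j, s y ≤ j → j + cnt G₂ y < e y →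
      wall Γ y (j + cnt G₂ y) W₁ = v * wall Γ y j W₁ * v⁻¹ := by
    intro y j hj hj'
    have := hcnt₂ y
    simp only [hs, he] at hj hj'
    rw [h.wall_eq, h.wall_eq]
    exact hwall₂ y j (by omega) (by omega)
  have hmid' : ∀ (R₁ R₂ : List (V × Bool)) (b : V × Bool), R = R₁ ++ b :: R₂ →
      s b.1 + cnt G₂ b.1 ≤ cnt X b.1 + cnt R₁ b.1 ∧
        cnt X b.1 + cnt R₁ b.1 + cnt G₁ b.1 < e b.1 := by
    intro R₁ R₂ b hb
    have := hmid R₁ R₂ b hb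
    simp only [hs, he]
    omega
  have hwin : ∀ b ∈ R, 0 < cnt G₁ b.1 ∧ 0 < cnt G₂ b.1 ∧
      s b.1 + cnt G₁ b.1 + cnt G₂ b.1 < e b.1 := by
    intro b hb
    obtain ⟨R₁, R₂, hR⟩ := List.append_of_mem hb
    have h₁ := hmid' R₁ R₂ b hR
    have h₂ := hcnt₁ b.1
    have h₃ := hcnt₂ b.1
    simp only [hs, he] at h₁ ⊢
    -- A vertex missing from a period occurs only in the two ends, which leaves no window for it.
    refine ⟨Nat.pos_of_ne_zero fun h₀ => ?_, Nat.pos_of_ne_zero fun h₀ => ?_, by omega⟩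
    · rw [h₀, mul_zero] at h₂
      omega
    · rw [h₀, mul_zero] at h₃
      omega
  have htriv : ∀ z : RAAG Γ, (∀ (R₁ R₂ : List (V × Bool)) (b : V × Bool), R = R₁ ++ b :: R₂ →
      Commute z (wall Γ b.1 (cnt X b.1 + cnt R₁ b.1) W₁)) → z = 1 := by
    intro z hz
    by_contra hne
    refine hR 1 (by norm_num) (HasStarCover.of_inStar
      (inStar_of_commute (z := (wordVal Γ X)⁻¹ * z * wordVal Γ X) ?_
        (commute_of_commute_wall (E := E) fun R₁ R₂ b hb => ?_)))
    · intro he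
      apply hne
      have := congrArg (fun t => wordVal Γ X * t * (wordVal Γ X)⁻¹) he
      simpa [mul_assoc] using this
    · rw [← hsw.wall_eq]
      exact hz R₁ R₂ b hb
  have huv : Commute u v := by
    have hz : u⁻¹ * v * u * v⁻¹ = 1 := by
      refine htriv _ fun R₁ R₂ b hb => ?_
      obtain ⟨h₁, h₂⟩ := hmid' R₁ R₂ b hb
      set y := b.1
      -- Stepping back by the second period keeps both routes from `i` to `i + cnt G₁ y + cnt G₂ y`
      -- inside the window. Comparing them shows that the commutator fixes the wall at `i + cnt G₂
      -- y`.
      obtain ⟨i, hi⟩ : ∃ i, cnt X y + cnt R₁ y = i + cnt G₂ y :=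
        ⟨cnt X y + cnt R₁ y - cnt G₂ y, by omega⟩
      rw [hi] at h₁ h₂ ⊢
      have e₁ := hv y i (by omega) (by omega)
      have e₂ := hu y i (by omega) (by omega)
      have e₃ := hv y (i + cnt G₁ y) (by omega) (by omega)
      have e₄ := hu y (i + cnt G₂ y) (by omega) (by omega)
      rw [add_right_comm, e₄, e₂, e₁] at e₃
      rw [e₁]
      set t := wall Γ y i W₁
      change _ = _
      have e₅ : v * t * v⁻¹ = u⁻¹ * (v * (u * t * u⁻¹) * v⁻¹) * u := by
        rw [← e₃]; group
      calc u⁻¹ * v * u * v⁻¹ * (v * t * v⁻¹)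
          = u⁻¹ * (v * (u * t * u⁻¹) * v⁻¹) * u * (u⁻¹ * v * u * v⁻¹) := by group
        _ = v * t * v⁻¹ * (u⁻¹ * v * u * v⁻¹) := by rw [← e₅]
    have : v * u = u * v := by
      have := congrArg (fun t => u * t * v) hz
      simpa [mul_assoc] using this
    exact this.symm
  have hratio : ∀ b ∈ R, ∀ x, ¬ Γ.Adj x b.1 →
      cnt G₂ b.1 * cnt G₁ x = cnt G₁ b.1 * cnt G₂ x := by
    intro b hb x hx
    obtain ⟨h₁, h₂, h₃⟩ := hwin b hb
    set y := b.1
    -- The sequence counts the letters `x` before the `j`-th `y`; it is the same for both words as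
    -- `x` and `y` are not adjacent.
    have := iterate_eq_of_shift (a := (· + cnt G₁ x)) (b := (· + cnt G₂ x))
      (T := fun j => cnt (pre y j W₁) x) (s := s y) (e := e y) (p := cnt G₁ y) (q := cnt G₂ y)
      (fun k => Nat.add_right_comm k _ _) h₁ h₃.le
      (fun j hj hj' => by
        have := hcnt₁ y
        simp only [hs, he] at hj hj'
        obtain ⟨D, h₄, h₅⟩ := hpre₁ y j (by omega) (by omega)
        rw [h₄, h₅]
        simp only [cnt_append]
        omega)
      (fun j hj hj' => by
        have := hcnt₂ y
        simp only [hs, he] at hj hj'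
        obtain ⟨D, h₄, h₅⟩ := hpre₂ y j (by omega) (by omega)
        rw [h.cnt_pre hx, h.cnt_pre hx, h₄, h₅]
        simp only [cnt_append]
        omega)
      (m := cnt G₂ y) (n := cnt G₁ y) (mul_comm _ _) (le_refl (s y)) (by omega)
    simpa [add_right_iterate] using this
  obtain ⟨c, hc⟩ : ∃ c, c ∈ R := by
    refine List.exists_mem_of_ne_nil R ?_
    rintro rfl
    exact hR 0 (by norm_num) HasStarCover.nil
  obtain ⟨hc₁, hc₂, -⟩ := hwin c hc
  have hall : ∀ b ∈ R, cnt G₂ c.1 * cnt G₁ b.1 = cnt G₁ c.1 * cnt G₂ b.1 := by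
    by_contra! hne
    obtain ⟨d, hd, hne⟩ := hne
    -- Nonadjacent letters share their ratio, so letters with the ratio of `c` are adjacent to all
    -- the others.
    refine hR 2 le_rfl (hasStarCover_two
      (fun x => cnt G₂ c.1 * cnt G₁ x = cnt G₁ c.1 * cnt G₂ x) hc hd (mul_comm _ _) hne ?_)
    intro a ha d hd hPa hPd
    by_contra hadj
    apply hPd
    have h₁ := hratio a ha d.1 fun h => hadj h.symm
    obtain ⟨h₂, -, -⟩ := hwin a ha
    refine Nat.eq_of_mul_eq_mul_left h₂ ?_
    calc cnt G₁ a.1 * (cnt G₂ c.1 * cnt G₁ d.1)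
        = cnt G₂ c.1 * cnt G₁ a.1 * cnt G₁ d.1 := by ring
      _ = cnt G₁ c.1 * (cnt G₂ a.1 * cnt G₁ d.1) := by rw [hPa]; ring
      _ = cnt G₁ a.1 * (cnt G₁ c.1 * cnt G₂ d.1) := by rw [h₁]; ring
  obtain ⟨k, p, q, hk, hpq, hp, hq⟩ :=
    Nat.exists_coprime' (m := cnt G₁ c.1) (n := cnt G₂ c.1) (Nat.gcd_pos_of_pos_left _ hc₁)
  have hpow : u ^ q = v ^ p := by
    -- At every letter of `R`, `q` steps of the first period and `p` of the second have the same
    -- total length, so `u ^ q` and `v ^ p` conjugate its wall alike.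
    refine inv_mul_eq_one.1 (htriv _ fun R₁ R₂ b hb => ?_)
    have hbR : b ∈ R := by rw [hb]; simp
    obtain ⟨h₁, h₂, h₃⟩ := hwin b hbR
    obtain ⟨h₄, h₅⟩ := hmid' R₁ R₂ b hb
    have h₆ := hall b hbR
    have h₇ : q * cnt G₁ b.1 = p * cnt G₂ b.1 := by
      refine Nat.eq_of_mul_eq_mul_left hk ?_
      rw [hp, hq] at h₆
      linarith
    have := iterate_eq_of_shift (a := fun t => u * t * u⁻¹) (b := fun t => v * t * v⁻¹)
      (T := fun j => wall Γ b.1 j W₁)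
      (fun t => by
        calc u * (v * t * v⁻¹) * u⁻¹ = (u * v) * t * (u * v)⁻¹ := by group
          _ = (v * u) * t * (v * u)⁻¹ := by rw [huv.eq]
          _ = v * (u * t * u⁻¹) * v⁻¹ := by group)
      h₁ h₃.le (hu b.1) (hv b.1) h₇ (j := cnt X b.1 + cnt R₁ b.1) (by omega) (by omega)
    rw [iterate_conj, iterate_conj] at this
    set t := wall Γ b.1 (cnt X b.1 + cnt R₁ b.1) W₁
    have h₈ := congrArg (fun r => (u ^ q)⁻¹ * r * v ^ p) this
    change _ = _
    simpa [mul_assoc] using h₈.symm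
  obtain ⟨r, hr₁, hr₂⟩ := exists_common_root huv hpq hpow
  have hp1 : p = 1 := by
    by_contra hne
    have : p ≠ 0 := by rintro rfl; omega
    exact hp₁'.2 r p (by omega) hr₁
  have hq1 : q = 1 := by
    by_contra hne
    have : q ≠ 0 := by rintro rfl; omega
    exact hp₂'.2 r q (by omega) hr₂
  rw [hr₁, hr₂, hp1, hq1]

theorem IsQuasiRootDecomp.conj_eq {h a₁ g₁ b₁ a₂ g₂ b₂ : RAAG Γ} {n₁ n₂ : ℕ}
    (hp₁ : IsPrimitive g₁) (h₁ : IsQuasiRootDecomp h a₁ g₁ b₁ n₁)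
    (hp₂ : IsPrimitive g₂) (h₂ : IsQuasiRootDecomp h a₂ g₂ b₂ n₂)
    (hstar : starLength a₁ + starLength a₂ + starLength g₁ + starLength g₂ + starLength b₁ +
      starLength b₂ + 2 < starLength h) :
    a₁ * g₁ * a₁⁻¹ = a₂ * g₂ * a₂⁻¹ := by
  obtain ⟨A₁, rfl, hA₁⟩ := exists_geodesic a₁
  obtain ⟨G₁, rfl, hG₁⟩ := exists_geodesic g₁
  obtain ⟨B₁, rfl, hB₁⟩ := exists_geodesic b₁
  obtain ⟨A₂, rfl, hA₂⟩ := exists_geodesic a₂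
  obtain ⟨G₂, rfl, hG₂⟩ := exists_geodesic g₂
  obtain ⟨B₂, rfl, hB₂⟩ := exists_geodesic b₂
  have e₁ : h = wordVal Γ (A₁ ++ wpow n₁ G₁ ++ B₁) := by
    rw [wordVal_append, wordVal_append, wordVal_wpow]
    exact h₁.eq_mul
  have e₂ : h = wordVal Γ (A₂ ++ wpow n₂ G₂ ++ B₂) := by
    rw [wordVal_append, wordVal_append, wordVal_wpow]
    exact h₂.eq_mul
  have r₁ : IsReduced Γ (A₁ ++ wpow n₁ G₁ ++ B₁) := by
    refine isReduced_of_geodesic ?_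
    rw [← e₁, h₁.length_eq, List.length_append, List.length_append, length_wpow, hA₁, hG₁, hB₁]
    ring
  have r₂ : IsReduced Γ (A₂ ++ wpow n₂ G₂ ++ B₂) := by
    refine isReduced_of_geodesic ?_
    rw [← e₂, h₂.length_eq, List.length_append, List.length_append, length_wpow, hA₂, hG₂, hB₂]
    ring
  refine conj_eq_of_swap h₁.one_le h₂.one_le (r₁.swap_of_wordVal_eq r₂ (e₁.symm.trans e₂)) hp₁ hp₂
    (isReduced_of_geodesic hA₁).hasStarCover (isReduced_of_geodesic hG₁).hasStarCover
    (isReduced_of_geodesic hB₁).hasStarCover (isReduced_of_geodesic hA₂).hasStarCover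
    (isReduced_of_geodesic hG₂).hasStarCover (isReduced_of_geodesic hB₂).hasStarCover ?_
  rwa [← e₁]

/-- As `g` commutes with its powers, the rightward extraction is the leftward one conjugated by `h`.
-/
theorem IsQuasiRootDecomp.right_conj_eq {h a g b : RAAG Γ} {n : ℕ}
    (hd : IsQuasiRootDecomp h a g b n) : b⁻¹ * g * b = h⁻¹ * (a * g * a⁻¹) * h := by
  have hc : (g ^ n)⁻¹ * g * g ^ n = g := by
    rw [mul_assoc, (Commute.self_pow g n).eq, inv_mul_cancel_left]
  calc b⁻¹ * g * b = b⁻¹ * ((g ^ n)⁻¹ * g * g ^ n) * b := by rw [hc]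
    _ = h⁻¹ * (a * g * a⁻¹) * h := by rw [hd.eq_mul]; group

end RAAG

theorem mainTheorem4 {V : Type*} [Fintype V] (Γ : SimpleGraph V) (h : RAAG Γ) (A B r : ℝ)
    (hA : 0 ≤ A) (hB : 0 ≤ B) (hr : 1 ≤ r)
    (hh : 2 * A + 2 * B + (2 * (Fintype.card V : ℝ) + 3) * r + 2 ≤ (RAAG.starLength h : ℝ)) :
    (∀ g₁ g₂ : RAAG Γ,
      RAAG.IsPrimitive g₁ → RAAG.IsStarQuasiRoot A B r h g₁ →
      RAAG.IsPrimitive g₂ → RAAG.IsStarQuasiRoot A B r h g₂ →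
      IsConj g₁ g₂) ∧
    (∀ (a₁ g₁ b₁ a₂ g₂ b₂ : RAAG Γ) (n₁ n₂ : ℕ),
      RAAG.IsPrimitive g₁ → RAAG.IsStarQuasiRootDecomp A B r h a₁ g₁ b₁ n₁ →
      RAAG.IsPrimitive g₂ → RAAG.IsStarQuasiRootDecomp A B r h a₂ g₂ b₂ n₂ →
      a₁ * g₁ * a₁⁻¹ = a₂ * g₂ * a₂⁻¹ ∧ b₁⁻¹ * g₁ * b₁ = b₂⁻¹ * g₂ * b₂) := by
  have key : ∀ (a₁ g₁ b₁ a₂ g₂ b₂ : RAAG Γ) (n₁ n₂ : ℕ),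
      RAAG.IsPrimitive g₁ → RAAG.IsStarQuasiRootDecomp A B r h a₁ g₁ b₁ n₁ →
      RAAG.IsPrimitive g₂ → RAAG.IsStarQuasiRootDecomp A B r h a₂ g₂ b₂ n₂ →
      a₁ * g₁ * a₁⁻¹ = a₂ * g₂ * a₂⁻¹ := by
    intro a₁ g₁ b₁ a₂ g₂ b₂ n₁ n₂ hp₁ h₁ hp₂ h₂
    refine h₁.toIsQuasiRootDecomp.conj_eq hp₁ hp₂ h₂.toIsQuasiRootDecomp ?_
    -- The six star lengths plus 2 are at most `2A + 2B + 2r + 2`, strictly below the assumed bound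
    -- because `r ≥ 1`.
    have hV : 0 ≤ (Fintype.card V : ℝ) * r := by positivity
    have := h₁.left_le
    have := h₁.right_le
    have := h₁.root_le
    have := h₂.left_le
    have := h₂.right_le
    have := h₂.root_le
    rify
    nlinarith
  refine ⟨?_, fun a₁ g₁ b₁ a₂ g₂ b₂ n₁ n₂ hp₁ h₁ hp₂ h₂ => ?_⟩
  · rintro g₁ g₂ hp₁ ⟨a₁, b₁, n₁, h₁⟩ hp₂ ⟨a₂, b₂, n₂, h₂⟩
    have hk := key a₁ g₁ b₁ a₂ g₂ b₂ n₁ n₂ hp₁ h₁ hp₂ h₂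
    refine (isConj_iff.2 ⟨a₁, hk⟩).trans (isConj_iff.2 ⟨a₂, rfl⟩).symm
  · have hk := key a₁ g₁ b₁ a₂ g₂ b₂ n₁ n₂ hp₁ h₁ hp₂ h₂
    refine ⟨hk, ?_⟩
    rw [h₁.toIsQuasiRootDecomp.right_conj_eq, h₂.toIsQuasiRootDecomp.right_conj_eq, hk]
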